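/- Let $K$ arms have distributions $\nu=(\nu_a)_{a\in[K]}$ on $\mathbb R$ with means $\mu_a$, each $1$-sub-Gaussian, i.e. $\mathbb E_{X\sim\nu_a}[e^{\lambda(X-\mu_a)}]\le e^{\lambda^2/2}$ for all $\lambda\in\mathbb R$. Let $\theta\in\mathbb R$ be a threshold, $\mathcal A_\theta=\{a:\mu_a\ge\theta\}$ the set of good arms, $\Delta_a=|\mu_a-\theta|$, and $H_1(\mu)=\sum_a\Delta_a^{-2}$. Assume $\Delta_a>0$ for all $a$. At each round an arm is pulled, and given the past and the arm $a$ pulled, the reward is drawn from $\nu_a$. Let $N_a(t)$ and $\hat\mu_a(t)$ be the number of pulls and the empirical mean of arm $a$ after $t$ rounds, $W_a^{\pm}(t)=\sqrt{N_a(t)}\,\max(\pm(\hat\mu_a(t)-\theta),0)$, and let $n_0\ge1$ be an integer. The APGAI algorithm first pulls every arm exactly $n_0$ times. Then, for each $t\ge n_0K$: if $\max_a\hat\mu_a(t)\le\theta$, it recommends $\hat a_t=\emptyset$ (``there is no good arm'') and pulls next some $a_{t+1}\in\arg\min_aW_a^-(t)$; otherwise it recommends and pulls next the same arm $\hat a_t=a_{t+1}\in\arg\max_aW_a^+(t)$.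 Ties are broken arbitrarily, possibly at random. The probability of error $P_\nu^{\mathrm{err}}(t)$ is $\mathbb P(\hat a_t\notin\mathcal A_\theta)$ (the recommendation $\emptyset$ included) if $\mathcal A_\theta\neq\emptyset$, and $\mathbb P(\hat a_t\ne\emptyset)$ if $\mathcal A_\theta=\emptyset$. Let $p(x)=x-\tfrac12\log x$, let $\alpha=9$ if $\mathcal A_\theta=\emptyset$ and $\alpha=2$ otherwise, and let $$x_t=\frac{t-n_0K-2|\mathcal A_\theta|}{2\alpha H_1(\mu)}.$$ Then, for every deterministic time $t>n_0K+2|\mathcal A_\theta|$, $$P_\nu^{\mathrm{err}}(t)\le K e\sqrt2\,\log(e^2t)\,\exp\bigl(-p(\max\{x_t,\tfrac12\})\bigr);$$ in particular the bound is $K e\sqrt2\,\log(e^2t)\,e^{-p(x_t)}$ whenever $t\ge n_0K+2|\mathcal A_\theta|+\alpha H_1(\mu)$, while for smaller $t$ it exceeds $1$. Hence, for every $c<1$, one has $P_\nu^{\mathrm{err}}(t)\le\exp\bigl(-c\,t/(2\alpha H_1(\mu))\bigr)$ for all sufficiently large $t$. -/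

import Mathlib

open MeasureTheory ProbabilityTheory Filter

noncomputable section

namespace GoodArm

/-! ### Instances -/

/-- The mean of arm `a`. -/
def armMean {K : ℕ} (ν : Fin K → Measure ℝ) (a : Fin K) : ℝ := ∫ x, x ∂(ν a)

/-- A distribution is 1-sub-Gaussian: `𝔼[exp (l (X - m))] ≤ exp (l ^ 2 / 2)` for all real `l`,
where `m` is its mean. -/
def IsOneSubGaussian (ρ : Measure ℝ) : Prop :=
  HasSubgaussianMGF (fun x : ℝ => x - ∫ y, y ∂ρ) 1 ρ

/-- The set of good arms. -/
def goodArms {K : ℕ} (ν : Fin K → Measure ℝ) (θ : ℝ) : Set (Fin K) := {a | θ ≤ armMean ν a}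

/-- The gap of arm `a` to the threshold. -/
def gap {K : ℕ} (ν : Fin K → Measure ℝ) (θ : ℝ) (a : Fin K) : ℝ := |armMean ν a - θ|

/-- The complexity `H₁(μ) = ∑ₐ Δₐ⁻²`. -/
def H1 {K : ℕ} (ν : Fin K → Measure ℝ) (θ : ℝ) : ℝ := ∑ a, (gap ν θ a ^ 2)⁻¹

open Classical in
/-- `2` if there is a good arm, `9` otherwise. -/
def alpha {K : ℕ} (ν : Fin K → Measure ℝ) (θ : ℝ) : ℝ := if (goodArms ν θ).Nonempty then 2 else 9

/-! ### Interaction of a sampling rule with an instance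

Rounds are counted from `0`: `arm s` and `reward s` are the arm pulled and the reward received in
the `(s+1)`-th round. After `t` rounds, the past is given by the indices `s < t`, and `arm t` is
the arm to be pulled next. -/

section Interaction

variable {Ω : Type*} {K : ℕ}

/-- The arms pulled and rewards received in the first `t` rounds. -/
def history (arm : ℕ → Ω → Fin K) (reward : ℕ → Ω → ℝ) (t : ℕ) (ω : Ω) : Fin t → Fin K × ℝ :=
  fun s => (arm s ω, reward s ω)

/-- Given the history and the arm pulled, the reward is drawn from the distribution of that arm.
The choice of the arm may depend on the history and on additional randomness. -/
structure IsBanditProcess [MeasurableSpace Ω] (P : Measure Ω) (ν : Fin K → Measure ℝ)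
    (arm : ℕ → Ω → Fin K) (reward : ℕ → Ω → ℝ) : Prop where
  measurable_arm : ∀ s, Measurable (arm s)
  measurable_reward : ∀ s, Measurable (reward s)
  reward_law : ∀ s, HasCondDistrib (reward s) (fun ω => (history arm reward s ω, arm s ω))
    (Kernel.prodMkLeft (Fin s → Fin K × ℝ) (Kernel.ofFunOfCountable ν)) P

/-- The number of times arm `a` has been pulled in the first `t` rounds. -/
def pulls (arm : ℕ → Ω → Fin K) (a : Fin K) (t : ℕ) (ω : Ω) : ℕ :=
  ((Finset.range t).filter fun s => arm s ω = a).card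

/-- The empirical mean of arm `a` after `t` rounds. -/
def empMean (arm : ℕ → Ω → Fin K) (reward : ℕ → Ω → ℝ) (a : Fin K) (t : ℕ) (ω : Ω) : ℝ :=
  (∑ s ∈ (Finset.range t).filter fun s => arm s ω = a, reward s ω) / (pulls arm a t ω : ℝ)

/-- The empirical transportation cost `W⁺`. -/
def Wplus (θ : ℝ) (arm : ℕ → Ω → Fin K) (reward : ℕ → Ω → ℝ) (a : Fin K) (t : ℕ) (ω : Ω) : ℝ :=
  √(pulls arm a t ω : ℝ) * max (empMean arm reward a t ω - θ) 0

/-- The empirical transportation cost `W⁻`. -/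
def Wminus (θ : ℝ) (arm : ℕ → Ω → Fin K) (reward : ℕ → Ω → ℝ) (a : Fin K) (t : ℕ) (ω : Ω) : ℝ :=
  √(pulls arm a t ω : ℝ) * max (-(empMean arm reward a t ω - θ)) 0

/-- The maximum over the arms of the empirical means after `t` rounds is at most `θ`. -/
def AllBelow (θ : ℝ) (arm : ℕ → Ω → Fin K) (reward : ℕ → Ω → ℝ) (t : ℕ) (ω : Ω) : Prop :=
  ∀ a, empMean arm reward a t ω ≤ θ

/-- The arms and the recommendations follow the APGAI algorithm with threshold `θ` and `n₀` initial
pulls of each arm, almost surely. Ties are broken arbitrarily, possibly at random; `none` stands for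
the answer that there is no good arm. -/
structure IsAPGAI [MeasurableSpace Ω] (P : Measure Ω) (n₀ : ℕ) (θ : ℝ)
    (arm : ℕ → Ω → Fin K) (reward : ℕ → Ω → ℝ) (rec : ℕ → Ω → Option (Fin K)) : Prop where
  init : ∀ᵐ ω ∂P, ∀ a, pulls arm a (n₀ * K) ω = n₀
  step_below : ∀ᵐ ω ∂P, ∀ t, n₀ * K ≤ t → AllBelow θ arm reward t ω →
    rec t ω = none ∧ ∀ b, Wminus θ arm reward (arm t ω) t ω ≤ Wminus θ arm reward b t ω
  step_above : ∀ᵐ ω ∂P, ∀ t, n₀ * K ≤ t → ¬ AllBelow θ arm reward t ω →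
    rec t ω = some (arm t ω) ∧
      ∀ b, Wplus θ arm reward b t ω ≤ Wplus θ arm reward (arm t ω) t ω

/-- The event that the recommendation after `t` rounds is wrong. -/
def errorEvent (ν : Fin K → Measure ℝ) (θ : ℝ) (rec : ℕ → Ω → Option (Fin K)) (t : ℕ) : Set Ω :=
  {ω | ((goodArms ν θ).Nonempty ∧ (rec t ω = none ∨ ∃ a, a ∉ goodArms ν θ ∧ rec t ω = some a)) ∨
    (¬ (goodArms ν θ).Nonempty ∧ rec t ω ≠ none)}

end Interaction

/-! ### The bound -/

/-- The function `p(x) = x - (log x) / 2`. -/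
def p (x : ℝ) : ℝ := x - Real.log x / 2

/-- The rescaled time `(t - n₀ K - 2 |A_θ|) / (2 α H₁(μ))`. -/
def scaledTime {K : ℕ} (ν : Fin K → Measure ℝ) (θ : ℝ) (n₀ t : ℕ) : ℝ :=
  ((t : ℝ) - n₀ * K - 2 * (goodArms ν θ).ncard) / (2 * alpha ν θ * H1 ν θ)

end GoodArm

end

/-! For a fixed tilt `l`, sub-Gaussianity makes the exponential of `logProcess` a nonnegative
supermartingale under any sampling rule. So is its average over tilts, and Ville's inequality bounds
the probability that it ever reaches `e^y` by `e^(-y)`. Mixing one arm's coordinate over centered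
Gaussians, with one variance per geometric slice of its pull count, gives time-uniform bounds that
couple the noise of that arm with a fixed tilt of the others (`measureReal_exists_logProcess_le`).
The slices cost the factor `log(e²t)/2`.

The rest is pathwise. Split `√N (μ̂ - θ)` into noise plus drift `√N (μ - θ)`, and look at an
over-pulled arm at its last pull.

Without good arms, suppose every noise stays below `R = √(2x)`. At time `t ≥ n₀K + 18xH₁` some arm
has drift below `-3R` at its last pull, hence `W⁻ > 2R`. An arm that looks good at time `t` has
drift above `-R`, so its earlier `W⁻` is below `2R` and it would have been preferred
(`allBelow_of_concentration`).

With a good arm, an error at time `t ≥ n₀K + 4xH₁` forces either a bad arm to have been pulled often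
although a good arm was available (`exists_tilted_pair_of_bad_pull`), or the good arms to hold many
pulls while no good arm is recommended (`le_logProcess_goodTilt`). Both are joint deviations: a tilt
contributes at least `3Z²/8 - Zw/2`, while another arm has noise at least `w` in absolute value,
worth about `w²/2`. The sum is `Z²/4 + (w - Z/2)²/2`, at least `x` when `Z² ≥ 4x`. The degenerate
case in which all means look bad has `w = 0` and needs only the tilt. -/

noncomputable section

namespace GoodArm

open scoped ENNReal NNReal

/-! ### Exponential supermartingales, mixtures and Ville's inequality -/

section Supermartingale

variable {Ω : Type*} {K : ℕ}

/-- The logarithm of the exponential process with tilt `l`. -/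
def logProcess (m : Fin K → ℝ) (arm : ℕ → Ω → Fin K) (reward : ℕ → Ω → ℝ) (l : Fin K → ℝ)
    (t : ℕ) (ω : Ω) : ℝ :=
  ∑ s ∈ Finset.range t,
    (l (arm s ω) * (reward s ω - m (arm s ω)) - l (arm s ω) ^ 2 / 2)

/-- The exponential process with a random tilt, integrated over the law of the tilt. -/
def mixture (m : Fin K → ℝ) (arm : ℕ → Ω → Fin K) (reward : ℕ → Ω → ℝ) (ρ : Measure ℝ)
    (l : ℝ → Fin K → ℝ) (t : ℕ) (ω : Ω) : ℝ≥0∞ :=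
  ∫⁻ u, ENNReal.ofReal (Real.exp (logProcess m arm reward (l u) t ω)) ∂ρ

variable {arm : ℕ → Ω → Fin K} {reward : ℕ → Ω → ℝ} {m : Fin K → ℝ}

/-- The σ-algebra generated by the first `t` rounds. -/
abbrev past (arm : ℕ → Ω → Fin K) (reward : ℕ → Ω → ℝ) (t : ℕ) : MeasurableSpace Ω :=
  MeasurableSpace.comap (history arm reward t) inferInstance

lemma past_measurable_arm {s t : ℕ} (h : s < t) : Measurable[past arm reward t] (arm s) := by
  have h1 : Measurable[past arm reward t] (history arm reward t) := comap_measurable _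
  exact (measurable_fst.comp (measurable_pi_apply (⟨s, h⟩ : Fin t))).comp h1

lemma past_measurable_reward {s t : ℕ} (h : s < t) :
    Measurable[past arm reward t] (reward s) := by
  have h1 : Measurable[past arm reward t] (history arm reward t) := comap_measurable _
  exact (measurable_snd.comp (measurable_pi_apply (⟨s, h⟩ : Fin t))).comp h1

lemma past_measurable_logProcess {l : ℝ → Fin K → ℝ} (hl : Measurable l) {s t : ℕ} (h : s ≤ t) :
    Measurable[(inferInstance : MeasurableSpace ℝ).prod (past arm reward t)]
      (fun q : ℝ × Ω => logProcess m arm reward (l q.1) s q.2) := by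
  let _ : MeasurableSpace Ω := past arm reward t
  unfold logProcess
  refine Finset.measurable_sum _ fun i hi => ?_
  have hi' : i < t := lt_of_lt_of_le (Finset.mem_range.1 hi) h
  have ha : Measurable (arm i) := past_measurable_arm hi'
  have hr : Measurable (reward i) := past_measurable_reward hi'
  have hm : Measurable m := measurable_of_countable m
  have h1 : Measurable fun q : ℝ × Fin K => l q.1 q.2 :=
    measurable_from_prod_countable_left fun a => (measurable_pi_apply a).comp hl
  have h2 : Measurable fun q : ℝ × Ω => l q.1 (arm i q.2) :=
    h1.comp (measurable_fst.prodMk (ha.comp measurable_snd))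
  exact (h2.mul ((hr.comp measurable_snd).sub (hm.comp (ha.comp measurable_snd)))).sub
    ((h2.pow_const 2).div_const 2)

lemma past_measurable_mixture {ρ : Measure ℝ} [SFinite ρ] {l : ℝ → Fin K → ℝ} (hl : Measurable l)
    {s t : ℕ} (h : s ≤ t) :
    Measurable[past arm reward t] (mixture m arm reward ρ l s) := by
  let _ : MeasurableSpace Ω := past arm reward t
  have := past_measurable_logProcess (arm := arm) (reward := reward) (m := m) hl h
  exact Measurable.lintegral_prod_left' (f := fun q : ℝ × Ω =>
    ENNReal.ofReal (Real.exp (logProcess m arm reward (l q.1) s q.2)))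
    (this.exp.ennreal_ofReal)

variable [MeasurableSpace Ω] {P : Measure Ω} {ν : Fin K → Measure ℝ}

lemma past_le (hb : IsBanditProcess P ν arm reward) (t : ℕ) :
    past arm reward t ≤ (inferInstance : MeasurableSpace Ω) := by
  apply Measurable.comap_le
  exact measurable_pi_lambda _ fun i => (hb.measurable_arm i).prodMk (hb.measurable_reward i)

lemma lintegral_exp_le_one {ρ : Measure ℝ} (h : IsOneSubGaussian ρ) (l : ℝ) :
    ∫⁻ y, ENNReal.ofReal (Real.exp (l * (y - ∫ z, z ∂ρ) - l ^ 2 / 2)) ∂ρ ≤ 1 := by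
  have h1 := h.integrable_exp_mul l
  have h2 := h.mgf_le l
  have h3 : ∀ y : ℝ, Real.exp (l * (y - ∫ z, z ∂ρ) - l ^ 2 / 2) =
      Real.exp (l * (y - ∫ z, z ∂ρ)) * Real.exp (-(l ^ 2 / 2)) := fun y => by
    rw [← Real.exp_add]; ring_nf
  simp_rw [h3]
  rw [← ofReal_integral_eq_lintegral_ofReal (h1.mul_const _) (ae_of_all _ fun y => by positivity),
    integral_mul_const]
  rw [ENNReal.ofReal_le_one]
  calc _ ≤ Real.exp ((1 : ℝ≥0) * l ^ 2 / 2) * Real.exp (-(l ^ 2 / 2)) := by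
        gcongr; exact h2
    _ = 1 := by rw [← Real.exp_add]; simp

/-- `F` factors through the history, so disintegrating the law of (history, arm, reward) lets the
reward be integrated first, at fixed history and arm. -/
lemma lintegral_mul_step_le [IsProbabilityMeasure P] (hprob : ∀ a, IsProbabilityMeasure (ν a))
    (hb : IsBanditProcess P ν arm reward) (s : ℕ) {F : Ω → ℝ≥0∞}
    (hF : Measurable[past arm reward s] F) {g : Fin K → ℝ → ℝ≥0∞} (hg : ∀ a, Measurable (g a))
    (hg1 : ∀ a, ∫⁻ y, g a y ∂(ν a) ≤ 1) :
    ∫⁻ ω, F ω * g (arm s ω) (reward s ω) ∂P ≤ ∫⁻ ω, F ω ∂P := by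
  obtain ⟨f, hf, rfl⟩ := hF.exists_eq_measurable_comp
  have : IsMarkovKernel (Kernel.ofFunOfCountable ν) := ⟨fun a => hprob a⟩
  have hlaw := hb.reward_law s
  set X : Ω → (Fin s → Fin K × ℝ) × Fin K := fun ω => (history arm reward s ω, arm s ω)
  have hh : Measurable (history arm reward s) := measurable_pi_lambda _ fun i =>
    (hb.measurable_arm i).prodMk (hb.measurable_reward i)
  have hX : Measurable X := hh.prodMk (hb.measurable_arm s)
  have hg2 : Measurable fun q : Fin K × ℝ => g q.1 q.2 := measurable_from_prod_countable_right hg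
  have hφ : Measurable fun q : ((Fin s → Fin K × ℝ) × Fin K) × ℝ => f q.1.1 * g q.1.2 q.2 :=
    (hf.comp (measurable_fst.comp measurable_fst)).mul
      (hg2.comp ((measurable_snd.comp measurable_fst).prodMk measurable_snd))
  calc ∫⁻ ω, (f ∘ history arm reward s) ω * g (arm s ω) (reward s ω) ∂P
      = ∫⁻ q, f q.1.1 * g q.1.2 q.2 ∂(P.map fun ω => (X ω, reward s ω)) := by
        rw [lintegral_map hφ (hX.prodMk (hb.measurable_reward s))]; rfl
    _ = ∫⁻ q, ∫⁻ y, f q.1 * g q.2 y ∂(ν q.2) ∂(P.map X) := by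
        rw [hlaw.map_eq, Measure.lintegral_compProd hφ]
        rfl
    _ ≤ ∫⁻ q, f q.1 ∂(P.map X) := by
        refine lintegral_mono fun q => ?_
        rw [lintegral_const_mul _ (hg _)]
        exact mul_le_of_le_one_right' (hg1 _)
    _ = _ := by
        rw [lintegral_map (f := fun q : (Fin s → Fin K × ℝ) × Fin K => f q.1)
          (hf.comp measurable_fst) hX]; rfl

lemma setLIntegral_exp_logProcess_succ_le [IsProbabilityMeasure P]
    (hprob : ∀ a, IsProbabilityMeasure (ν a)) (hsub : ∀ a, IsOneSubGaussian (ν a))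
    (hb : IsBanditProcess P ν arm reward) (l : Fin K → ℝ) (s : ℕ) {A : Set Ω}
    (hA : MeasurableSet[past arm reward s] A) :
    ∫⁻ ω in A, ENNReal.ofReal (Real.exp (logProcess (armMean ν) arm reward l (s + 1) ω)) ∂P ≤
      ∫⁻ ω in A, ENNReal.ofReal (Real.exp (logProcess (armMean ν) arm reward l s ω)) ∂P := by
  have hA' := past_le hb s A hA
  rw [← lintegral_indicator hA', ← lintegral_indicator hA']
  set G : Ω → ℝ≥0∞ :=
    fun ω => ENNReal.ofReal (Real.exp (logProcess (armMean ν) arm reward l s ω)) with hG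
  have hGm : Measurable[past arm reward s] G := by
    let _ : MeasurableSpace Ω := past arm reward s
    have := past_measurable_logProcess (arm := arm) (reward := reward) (m := armMean ν)
      (l := fun _ => l) measurable_const (le_refl s)
    exact (this.comp (measurable_prodMk_left (x := (0 : ℝ)))).exp.ennreal_ofReal
  have hF : Measurable[past arm reward s] (A.indicator G) := hGm.indicator hA
  refine le_trans (le_of_eq ?_) (lintegral_mul_step_le hprob hb s hF (g := fun a y =>
    ENNReal.ofReal (Real.exp (l a * (y - armMean ν a) - l a ^ 2 / 2)))
    (fun a => by fun_prop) (fun a => lintegral_exp_le_one (hsub a) (l a)))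
  congr 1 with ω
  by_cases hω : ω ∈ A
  · simp only [hω, Set.indicator_of_mem, hG]
    rw [← ENNReal.ofReal_mul (Real.exp_nonneg _), ← Real.exp_add, logProcess, logProcess,
      Finset.sum_range_succ]
  · simp [hω]

lemma setLIntegral_mixture_succ_le [IsProbabilityMeasure P]
    (hprob : ∀ a, IsProbabilityMeasure (ν a)) (hsub : ∀ a, IsOneSubGaussian (ν a))
    (hb : IsBanditProcess P ν arm reward) {ρ : Measure ℝ} [SFinite ρ] {l : ℝ → Fin K → ℝ}
    (hl : Measurable l) (s : ℕ) {A : Set Ω} (hA : MeasurableSet[past arm reward s] A) :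
    ∫⁻ ω in A, mixture (armMean ν) arm reward ρ l (s + 1) ω ∂P ≤
      ∫⁻ ω in A, mixture (armMean ν) arm reward ρ l s ω ∂P := by
  have hm : ∀ t, Measurable fun q : ℝ × Ω =>
      ENNReal.ofReal (Real.exp (logProcess (armMean ν) arm reward (l q.1) t q.2)) := fun t =>
    ((past_measurable_logProcess hl (le_refl t)).mono
      (sup_le_sup le_rfl (MeasurableSpace.comap_mono (past_le hb t))) le_rfl).exp.ennreal_ofReal
  unfold mixture
  have hswap : ∀ t, ∫⁻ ω in A, ∫⁻ u, ENNReal.ofReal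
      (Real.exp (logProcess (armMean ν) arm reward (l u) t ω)) ∂ρ ∂P =
      ∫⁻ u, ∫⁻ ω in A, ENNReal.ofReal
        (Real.exp (logProcess (armMean ν) arm reward (l u) t ω)) ∂P ∂ρ := fun t =>
    lintegral_lintegral_swap ((hm t).comp measurable_swap).aemeasurable
  rw [hswap, hswap]
  exact lintegral_mono fun u => setLIntegral_exp_logProcess_succ_le hprob hsub hb (l u) s hA

/-- Ville's inequality. -/
lemma measure_exists_le_mixture_le [IsProbabilityMeasure P]
    (hprob : ∀ a, IsProbabilityMeasure (ν a)) (hsub : ∀ a, IsOneSubGaussian (ν a))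
    (hb : IsBanditProcess P ν arm reward) {ρ : Measure ℝ} [IsProbabilityMeasure ρ]
    {l : ℝ → Fin K → ℝ} (hl : Measurable l) (c : ℝ≥0∞) (t : ℕ) :
    c * P {ω | ∃ s < t, c ≤ mixture (armMean ν) arm reward ρ l s ω} ≤ 1 := by
  set L := mixture (armMean ν) arm reward ρ l with hL
  set H : ℕ → Set Ω := fun t => {ω | ∃ s < t, c ≤ L s ω} with hH
  have hHm : ∀ t, MeasurableSet[past arm reward t] (H (t + 1)) := fun t => by
    have : H (t + 1) = ⋃ s ∈ Finset.range (t + 1), {ω | c ≤ L s ω} := by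
      ext ω; simp [hH]
    rw [this]
    refine Finset.measurableSet_biUnion _ fun s hs => ?_
    exact measurableSet_le measurable_const
      (past_measurable_mixture (ρ := ρ) hl (Nat.lt_succ_iff.1 (Finset.mem_range.1 hs)))
  have hHm' : ∀ t, MeasurableSet (H (t + 1)) := fun t => past_le hb t _ (hHm t)
  have hLm : ∀ t, Measurable (L t) := fun t =>
    (past_measurable_mixture (ρ := ρ) hl le_rfl).mono (past_le hb t) le_rfl
  -- Optional stopping as an invariant: paths that have crossed contribute `c`, the others keep
  -- their current value. Because `H t` only looks strictly before `t`, `H (t + 1)` is known from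
  -- the first `t` rounds and the supermartingale step applies on its complement.
  have key : ∀ t, c * P (H t) + ∫⁻ ω in (H t)ᶜ, L t ω ∂P ≤ 1 := by
    intro t
    induction t with
    | zero => simp [hH, hL, mixture, logProcess]
    | succ t ih =>
      set B : Set Ω := (H t)ᶜ ∩ {ω | c ≤ L t ω} with hB
      have hsplit : H (t + 1) = H t ∪ B := by
        ext ω
        simp only [hH, hB, Set.mem_ofPred_eq, Set.mem_union, Set.mem_inter_iff, Set.mem_compl_iff]
        constructor
        · rintro ⟨s, hs, h⟩
          by_cases h' : ∃ s < t, c ≤ L s ω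
          · exact Or.inl h'
          · refine Or.inr ⟨h', ?_⟩
            rcases Nat.lt_succ_iff_lt_or_eq.1 hs with h1 | rfl
            · exact absurd ⟨s, h1, h⟩ h'
            · exact h
        · rintro (⟨s, hs, h⟩ | ⟨-, h⟩)
          · exact ⟨s, by omega, h⟩
          · exact ⟨t, by omega, h⟩
      have hcompl : (H t)ᶜ = B ∪ (H (t + 1))ᶜ := by
        rw [hsplit]; ext ω; simp only [hB, Set.mem_union, Set.mem_compl_iff, Set.mem_inter_iff]
        tauto
      have hdisj : Disjoint B (H (t + 1))ᶜ := by
        rw [hsplit, Set.disjoint_left]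
        intro ω h1 h2
        exact h2 (Or.inr h1)
      have h1 : c * P B ≤ ∫⁻ ω in B, L t ω ∂P := by
        have hBm : MeasurableSet B := by
          refine MeasurableSet.inter ?_ (measurableSet_le measurable_const (hLm t))
          cases t with
          | zero => simp [hH]
          | succ t => exact (hHm' t).compl
        rw [← setLIntegral_const]
        exact setLIntegral_mono (hLm t) fun ω h => h.2
      calc c * P (H (t + 1)) + ∫⁻ ω in (H (t + 1))ᶜ, L (t + 1) ω ∂P
          ≤ c * (P (H t) + P B) + ∫⁻ ω in (H (t + 1))ᶜ, L t ω ∂P := by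
            refine add_le_add ?_ ?_
            · gcongr; rw [hsplit]; exact measure_union_le _ _
            · exact setLIntegral_mixture_succ_le (ρ := ρ) hprob hsub hb hl t (hHm t).compl
        _ ≤ c * P (H t) + (∫⁻ ω in B, L t ω ∂P + ∫⁻ ω in (H (t + 1))ᶜ, L t ω ∂P) := by
            rw [mul_add, add_assoc]; gcongr
        _ = c * P (H t) + ∫⁻ ω in (H t)ᶜ, L t ω ∂P := by
            rw [hcompl, lintegral_union (hHm' t).compl hdisj]
        _ ≤ 1 := ih
  exact le_trans le_self_add (key t)

lemma measureReal_exists_exp_le_mixture_le [IsProbabilityMeasure P]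
    (hprob : ∀ a, IsProbabilityMeasure (ν a)) (hsub : ∀ a, IsOneSubGaussian (ν a))
    (hb : IsBanditProcess P ν arm reward) {ρ : Measure ℝ} [IsProbabilityMeasure ρ]
    {l : ℝ → Fin K → ℝ} (hl : Measurable l) (y : ℝ) (t : ℕ) :
    P.real {ω | ∃ s ≤ t, ENNReal.ofReal (Real.exp y) ≤ mixture (armMean ν) arm reward ρ l s ω} ≤
      Real.exp (-y) := by
  have h := measure_exists_le_mixture_le hprob hsub hb (ρ := ρ) hl
    (ENNReal.ofReal (Real.exp y)) (t + 1)
  simp_rw [Nat.lt_succ_iff] at h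
  have h2 := ENNReal.toReal_mono ENNReal.one_ne_top h
  rw [ENNReal.toReal_mul, ENNReal.toReal_ofReal (Real.exp_nonneg _), ENNReal.toReal_one] at h2
  rw [Real.exp_neg, ← one_div, le_div_iff₀' (Real.exp_pos _)]
  exact h2

end Supermartingale

end GoodArm

end

noncomputable section

namespace GoodArm

open scoped ENNReal NNReal

/-! ### Gaussian mixtures in closed form -/

/-- Completing the square in `u`: prior times likelihood is evidence times posterior density. -/
lemma gaussianPDFReal_mul_exp {v : ℝ≥0} (hv : v ≠ 0) {n : ℝ} (hn : 0 ≤ n) (d u : ℝ) :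
    gaussianPDFReal 0 v u * Real.exp (u * d - n * u ^ 2 / 2) =
      Real.exp (v * d ^ 2 / (2 * (1 + n * v)) - Real.log (1 + n * v) / 2) *
        gaussianPDFReal (v * d / (1 + n * v)) (v / (1 + n.toNNReal * v)) u := by
  have hv' : (0 : ℝ) < v := NNReal.coe_pos.2 (pos_iff_ne_zero.2 hv)
  have hq : 0 < 1 + n * (v : ℝ) := by positivity
  have hsq : Real.exp (-(Real.log (1 + n * v) / 2)) = (√(1 + n * v))⁻¹ := by
    rw [Real.exp_neg, Real.sqrt_eq_rpow, Real.rpow_def_of_pos hq]; ring_nf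
  have hne : √(1 + n * v) ≠ 0 := (Real.sqrt_pos.2 hq).ne'
  rw [gaussianPDFReal, gaussianPDFReal]
  push_cast
  rw [Real.coe_toNNReal n hn, ← mul_div_assoc, Real.sqrt_div (by positivity), sub_eq_add_neg
    (_ / (2 * (1 + n * (v : ℝ)))), Real.exp_add, hsq, inv_div]
  have hexp : Real.exp (-(u - 0) ^ 2 / (2 * v)) * Real.exp (u * d - n * u ^ 2 / 2) =
      Real.exp (v * d ^ 2 / (2 * (1 + n * v))) *
        Real.exp (-(u - v * d / (1 + n * v)) ^ 2 / (2 * v / (1 + n * v))) := by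
    rw [← Real.exp_add, ← Real.exp_add]
    congr 1
    field_simp
    ring
  rw [mul_assoc, hexp]
  field_simp

lemma lintegral_exp_gaussianReal {v : ℝ≥0} (hv : v ≠ 0) {n : ℝ} (hn : 0 ≤ n) (d : ℝ) :
    ∫⁻ u, ENNReal.ofReal (Real.exp (u * d - n * u ^ 2 / 2)) ∂(gaussianReal 0 v) =
      ENNReal.ofReal
        (Real.exp (v * d ^ 2 / (2 * (1 + n * v)) - Real.log (1 + n * v) / 2)) := by
  have hw : v / (1 + n.toNNReal * v) ≠ 0 := by
    have : 1 + n.toNNReal * v ≠ 0 := by positivity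
    positivity
  rw [gaussianReal_of_var_ne_zero _ hv, lintegral_withDensity_eq_lintegral_mul _
    (measurable_gaussianPDF _ _) (by fun_prop)]
  simp only [Pi.mul_apply, gaussianPDF]
  simp_rw [← ENNReal.ofReal_mul (gaussianPDFReal_nonneg _ _ _), gaussianPDFReal_mul_exp hv hn,
    ENNReal.ofReal_mul (Real.exp_nonneg _)]
  rw [lintegral_const_mul _ (by fun_prop), lintegral_gaussianPDFReal_eq_one _ hw, mul_one]

/-! ### Peeling over the pull count of one arm -/

section Peeling

variable {Ω : Type*} {K : ℕ}

/-- The sum of the centered rewards of arm `a` in the first `t` rounds. -/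
def centeredSum (m : Fin K → ℝ) (arm : ℕ → Ω → Fin K) (reward : ℕ → Ω → ℝ) (a : Fin K) (t : ℕ)
    (ω : Ω) : ℝ :=
  ∑ s ∈ (Finset.range t).filter fun s => arm s ω = a, (reward s ω - m a)

variable {arm : ℕ → Ω → Fin K} {reward : ℕ → Ω → ℝ} {m : Fin K → ℝ}

lemma logProcess_eq_sum (l : Fin K → ℝ) (t : ℕ) (ω : Ω) :
    logProcess m arm reward l t ω =
      ∑ a, (l a * centeredSum m arm reward a t ω - pulls arm a t ω * l a ^ 2 / 2) := by
  rw [logProcess, ← Finset.sum_fiberwise (Finset.range t) (fun s => arm s ω)]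
  refine Finset.sum_congr rfl fun a _ => ?_
  rw [Finset.sum_congr rfl (g := fun s => l a * (reward s ω - m a) - l a ^ 2 / 2)
    (fun s hs => by rw [(Finset.mem_filter.1 hs).2]), Finset.sum_sub_distrib, ← Finset.mul_sum,
    Finset.sum_const, nsmul_eq_mul, centeredSum, pulls]
  ring

lemma logProcess_update {l : Fin K → ℝ} {b : Fin K} (hb : l b = 0) (u : ℝ) (t : ℕ) (ω : Ω) :
    logProcess m arm reward (Function.update l b u) t ω = logProcess m arm reward l t ω +
      (u * centeredSum m arm reward b t ω - pulls arm b t ω * u ^ 2 / 2) := by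
  rw [logProcess_eq_sum, logProcess_eq_sum, ← Finset.add_sum_erase _ _ (Finset.mem_univ b),
    ← Finset.add_sum_erase (a := b) Finset.univ (fun a => l a * _ - _) (Finset.mem_univ b),
    Finset.sum_congr rfl (s₁ := Finset.univ.erase b)
      (g := fun a => l a * centeredSum m arm reward a t ω - pulls arm a t ω * l a ^ 2 / 2)
      (fun a ha => by rw [Function.update_of_ne (Finset.ne_of_mem_erase ha)])]
  simp [hb]
  ring

lemma mixture_gaussianReal {l : Fin K → ℝ} {b : Fin K} (hb : l b = 0) {v : ℝ≥0} (hv : v ≠ 0)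
    (t : ℕ) (ω : Ω) :
    mixture m arm reward (gaussianReal 0 v) (Function.update l b) t ω =
      ENNReal.ofReal (Real.exp (logProcess m arm reward l t ω +
        (v * centeredSum m arm reward b t ω ^ 2 / (2 * (1 + pulls arm b t ω * v)) -
          Real.log (1 + pulls arm b t ω * v) / 2))) := by
  unfold mixture
  simp_rw [logProcess_update hb, Real.exp_add, ENNReal.ofReal_mul (Real.exp_nonneg _)]
  rw [lintegral_const_mul _ (by fun_prop), lintegral_exp_gaussianReal hv (Nat.cast_nonneg _)]

lemma pulls_le (a : Fin K) (t : ℕ) (ω : Ω) : pulls arm a t ω ≤ t :=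
  (Finset.card_filter_le _ _).trans (Finset.card_range t).le

variable [MeasurableSpace Ω] {P : Measure Ω} {ν : Fin K → Measure ℝ}

/-- Uniform concentration for one arm and a fixed tilt of the others. -/
lemma measureReal_exists_logProcess_le [IsProbabilityMeasure P]
    (hprob : ∀ a, IsProbabilityMeasure (ν a)) (hsub : ∀ a, IsOneSubGaussian (ν a))
    (hbp : IsBanditProcess P ν arm reward) {l : Fin K → ℝ} {b : Fin K} (hb : l b = 0)
    {x C : ℝ} (hx : 0 < x) (hC : 0 < C) {t : ℕ} (ht : 1 ≤ t) :
    P.real {ω | ∃ s ≤ t, 1 ≤ pulls arm b s ω ∧ ∀ q, x ≤ q → q ≤ Real.exp 2 * x →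
      x - Real.log (C * x) / 2 ≤ logProcess (armMean ν) arm reward l s ω +
        (q * (centeredSum (armMean ν) arm reward b s ω ^ 2 / pulls arm b s ω) / (2 * (1 + q)) -
          Real.log (1 + q) / 2)} ≤
      Real.log (Real.exp 1 ^ 2 * t) / 2 * (√(C * x) * Real.exp (-x)) := by
  set J := ⌊Real.log t / 2⌋₊ + 1 with hJ
  -- Slice `j` holds the pull counts `n` in `[e^(2j), e^(2j+2))`; there `q = n * v j` lies in `[x,
  -- e² x]`, the range over which `q` is quantified in the event.
  set v : ℕ → ℝ≥0 := fun j => (x * Real.exp (-(2 * j))).toNNReal with hv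
  have hvc : ∀ j, (v j : ℝ) = x * Real.exp (-(2 * j)) := fun j =>
    Real.coe_toNNReal _ (by positivity)
  have hv0 : ∀ j, v j ≠ 0 := fun j => by
    rw [← NNReal.coe_ne_zero, hvc]; positivity
  have ht0 : (0 : ℝ) < t := by exact_mod_cast ht
  have hlogt : 0 ≤ Real.log t := Real.log_nonneg (by exact_mod_cast ht)
  have hJle : (J : ℝ) ≤ Real.log (Real.exp 1 ^ 2 * t) / 2 := by
    rw [Real.log_mul (by positivity) ht0.ne', Real.log_pow, Real.log_exp, hJ]
    push_cast
    linarith [Nat.floor_le (show 0 ≤ Real.log t / 2 by positivity)]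
  set y := x - Real.log (C * x) / 2 with hy
  have hexp : Real.exp (-y) = √(C * x) * Real.exp (-x) := by
    rw [Real.sqrt_eq_rpow, Real.rpow_def_of_pos (by positivity), ← Real.exp_add, hy]
    ring_nf
  calc _ ≤ P.real (⋃ j ∈ Finset.range J, {ω | ∃ s ≤ t, ENNReal.ofReal (Real.exp y) ≤
          mixture (armMean ν) arm reward (gaussianReal 0 (v j)) (Function.update l b) s ω}) := by
        refine measureReal_mono ?_ (measure_ne_top _ _)
        rintro ω ⟨s, hs, hN, h⟩
        have hN0 : (1 : ℝ) ≤ pulls arm b s ω := by exact_mod_cast hN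
        have hNt : (pulls arm b s ω : ℝ) ≤ t := by 
          exact_mod_cast (pulls_le b s ω).trans hs
        set n := (pulls arm b s ω : ℝ) with hn
        have hn0 : 0 < n := by linarith
        have hlog : 0 ≤ Real.log n / 2 := by have := Real.log_nonneg hN0; positivity
        set j := ⌊Real.log n / 2⌋₊ with hj
        have hj1 : (j : ℝ) ≤ Real.log n / 2 := Nat.floor_le hlog
        have hj2 : Real.log n / 2 < j + 1 := Nat.lt_floor_add_one _
        have hjJ : j < J := by
          rw [hJ, Nat.lt_succ_iff]
          exact Nat.floor_le_floor (by
            have := Real.log_le_log hn0 hNt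
            linarith)
        simp only [Set.mem_iUnion, Finset.mem_range]
        refine ⟨j, hjJ, s, hs, ?_⟩
        rw [mixture_gaussianReal hb (hv0 j)]
        refine ENNReal.ofReal_le_ofReal (Real.exp_le_exp.2 ?_)
        have hq : n * (v j : ℝ) = x * Real.exp (Real.log n - 2 * j) := by
          rw [hvc, sub_eq_add_neg, Real.exp_add, Real.exp_log hn0]; ring
        refine (h (n * v j) ?_ ?_).trans (le_of_eq ?_)
        · rw [hq]
          exact le_mul_of_one_le_right hx.le (Real.one_le_exp (by linarith))
        · rw [hq, mul_comm]
          exact mul_le_mul_of_nonneg_right (Real.exp_le_exp.2 (by linarith)) hx.le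
        · congr 3
          field_simp
    _ ≤ ∑ j ∈ Finset.range J, P.real {ω | ∃ s ≤ t, ENNReal.ofReal (Real.exp y) ≤
          mixture (armMean ν) arm reward (gaussianReal 0 (v j)) (Function.update l b) s ω} :=
        measureReal_biUnion_finset_le _ _
    _ ≤ ∑ j ∈ Finset.range J, Real.exp (-y) := Finset.sum_le_sum fun j _ =>
        measureReal_exists_exp_le_mixture_le hprob hsub hbp (measurable_update l) y t
    _ = J * (√(C * x) * Real.exp (-x)) := by rw [Finset.sum_const, Finset.card_range,
        nsmul_eq_mul, hexp]
    _ ≤ _ := by gcongr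

/-! ### Numerical inequalities on a slice -/

lemma exp_two_le : Real.exp 2 ≤ 7.4 := by
  have h : Real.exp 2 = Real.exp 1 ^ 2 := by rw [← Real.exp_nat_mul]; norm_num
  rw [h]
  nlinarith [Real.exp_one_lt_d9, Real.exp_pos 1]

lemma exp_le_one_add_two_mul {y : ℝ} (h0 : 0 ≤ y) (h1 : y ≤ 1) : Real.exp y ≤ 1 + 2 * y := by
  have := Real.abs_exp_sub_one_sub_id_le (x := y) (by rw [abs_of_nonneg h0]; exact h1)
  nlinarith [(abs_le.1 this).2]

lemma div_add_log_one_add_le {x q : ℝ} (hx : 1 ≤ x) (h1 : x ≤ q) (h2 : q ≤ Real.exp 2 * x) :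
    x / q + Real.log (1 + q) ≤ Real.log (14 * x) := by
  have hq : 0 < q := by linarith
  rw [Real.le_log_iff_exp_le (by positivity), Real.exp_add, Real.exp_log (by positivity)]
  have h3 : x / q ≤ 1 := (div_le_one hq).2 h1
  have h4 : q ≤ 7.4 * x := h2.trans (mul_le_mul_of_nonneg_right exp_two_le (by linarith))
  calc Real.exp (x / q) * (1 + q) ≤ (1 + 2 * (x / q)) * (1 + q) := by
        gcongr; exact exp_le_one_add_two_mul (by positivity) h3
    _ = 1 + q + 2 * (x / q) + 2 * x := by field_simp; ring
    _ ≤ 14 * x := by linarith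

lemma two_mul_div_add_log_one_add_le {x q : ℝ} (hx : 1 ≤ x) (h1 : x ≤ q)
    (h2 : q ≤ Real.exp 2 * x) : 2 * (x / q) + Real.log (1 + q) ≤ Real.log (25 * x) := by
  have hq : 0 < q := by linarith
  rw [Real.le_log_iff_exp_le (by positivity), Real.exp_add, Real.exp_log (by positivity), two_mul,
    Real.exp_add]
  have h3 : x / q ≤ 1 := (div_le_one hq).2 h1
  have h4 : q ≤ 7.4 * x := h2.trans (mul_le_mul_of_nonneg_right exp_two_le (by linarith))
  have h5 : 0 ≤ x / q := by positivity
  calc Real.exp (x / q) * Real.exp (x / q) * (1 + q)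
      ≤ (1 + 2 * (x / q)) * (1 + 2 * (x / q)) * (1 + q) := by
        gcongr <;> exact exp_le_one_add_two_mul (by positivity) h3
    _ = 1 + q + 4 * (x / q) + 4 * x + 4 * (x / q) ^ 2 + 4 * (x / q) * x := by field_simp; ring
    _ ≤ 25 * x := by nlinarith

/-- Completing the square in `w` leaves `Z²/4 * (1 - 1/(2q))`. Thus a finite `q` costs `x/(2q)`,
which together with the mixture penalty `log(1 + q)/2` is absorbed in `log(14x)/2`. -/
lemma le_of_tilted_pair {x q T Z w g : ℝ} (hx : 1 ≤ x) (h1 : x ≤ q) (h2 : q ≤ Real.exp 2 * x)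
    (hZ : 4 * x ≤ Z ^ 2) (hT : 3 * Z ^ 2 / 8 - Z * w / 2 ≤ T) (hg : w ^ 2 ≤ g) :
    x - Real.log (14 * x) / 2 ≤ T + (q * g / (2 * (1 + q)) - Real.log (1 + q) / 2) := by
  have hq : 0 < q := by linarith
  have h3 := div_add_log_one_add_le hx h1 h2
  have h4 : q * w ^ 2 / (2 * (1 + q)) ≤ q * g / (2 * (1 + q)) := by gcongr
  have h5 : 3 * Z ^ 2 / 8 - Z * w / 2 + q * w ^ 2 / (2 * (1 + q)) =
      Z ^ 2 / 4 * (1 - 1 / (2 * q)) + q / (2 * (1 + q)) * (w - Z * (1 + q) / (2 * q)) ^ 2 := by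
    field_simp
    ring
  have h6 : 0 ≤ q / (2 * (1 + q)) * (w - Z * (1 + q) / (2 * q)) ^ 2 := by positivity
  have h7 : 0 ≤ 1 - 1 / (2 * q) := by
    rw [sub_nonneg, div_le_one (by positivity)]; linarith
  have h8 : x * (1 - 1 / (2 * q)) ≤ Z ^ 2 / 4 * (1 - 1 / (2 * q)) :=
    mul_le_mul_of_nonneg_right (by linarith) h7
  have h9 : x * (1 - 1 / (2 * q)) = x - x / q / 2 := by field_simp
  linarith

lemma le_of_deviation {x q g : ℝ} (hx : 1 ≤ x) (h1 : x ≤ q) (h2 : q ≤ Real.exp 2 * x)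
    (hg : 2 * x ≤ g) :
    x - Real.log (25 * x) / 2 ≤ q * g / (2 * (1 + q)) - Real.log (1 + q) / 2 := by
  have hq : 0 < q := by linarith
  have h3 := two_mul_div_add_log_one_add_le hx h1 h2
  have h4 : q * (2 * x) / (2 * (1 + q)) ≤ q * g / (2 * (1 + q)) := by gcongr
  have h5 : q * (2 * x) / (2 * (1 + q)) = x - x / (1 + q) := by field_simp; ring
  have h6 : x / (1 + q) ≤ x / q := by gcongr; linarith
  linarith

/-! ### Probabilities of the three kinds of deviation events -/

variable [IsProbabilityMeasure P]

lemma measureReal_exists_tilted_pair_le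
    (hprob : ∀ a, IsProbabilityMeasure (ν a)) (hsub : ∀ a, IsOneSubGaussian (ν a))
    (hbp : IsBanditProcess P ν arm reward) {l : Fin K → ℝ} {b : Fin K} (hb : l b = 0)
    {x : ℝ} (hx : 1 ≤ x) {t : ℕ} (ht : 1 ≤ t) :
    P.real {ω | ∃ s ≤ t, 1 ≤ pulls arm b s ω ∧ ∃ Z w : ℝ, 4 * x ≤ Z ^ 2 ∧
      3 * Z ^ 2 / 8 - Z * w / 2 ≤ logProcess (armMean ν) arm reward l s ω ∧
      w ^ 2 ≤ centeredSum (armMean ν) arm reward b s ω ^ 2 / pulls arm b s ω} ≤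
      Real.log (Real.exp 1 ^ 2 * t) / 2 * (√(14 * x) * Real.exp (-x)) := by
  refine (measureReal_mono ?_ (measure_ne_top _ _)).trans
    (measureReal_exists_logProcess_le hprob hsub hbp hb (by linarith : 0 < x)
      (by norm_num : (0 : ℝ) < 14) ht)
  rintro ω ⟨s, hs, hN, Z, w, hZ, hT, hg⟩
  exact ⟨s, hs, hN, fun q h1 h2 => le_of_tilted_pair hx h1 h2 hZ hT hg⟩

lemma measureReal_exists_deviation_le
    (hprob : ∀ a, IsProbabilityMeasure (ν a)) (hsub : ∀ a, IsOneSubGaussian (ν a))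
    (hbp : IsBanditProcess P ν arm reward) (b : Fin K)
    {x : ℝ} (hx : 1 ≤ x) {t : ℕ} (ht : 1 ≤ t) :
    P.real {ω | ∃ s ≤ t, 1 ≤ pulls arm b s ω ∧
      2 * x ≤ centeredSum (armMean ν) arm reward b s ω ^ 2 / pulls arm b s ω} ≤
      Real.log (Real.exp 1 ^ 2 * t) / 2 * (√(25 * x) * Real.exp (-x)) := by
  refine (measureReal_mono ?_ (measure_ne_top _ _)).trans
    (measureReal_exists_logProcess_le hprob hsub hbp (l := 0) (b := b) rfl (by linarith : 0 < x)
      (by norm_num : (0 : ℝ) < 25) ht)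
  rintro ω ⟨s, hs, hN, hg⟩
  refine ⟨s, hs, hN, fun q h1 h2 => ?_⟩
  have h0 : logProcess (armMean ν) arm reward 0 s ω = 0 := by simp [logProcess]
  rw [h0, zero_add]
  exact le_of_deviation hx h1 h2 hg

/-- A fixed tilt is a mixture over a Dirac mass, so no peeling factor appears. -/
lemma measureReal_exists_le_logProcess_le
    (hprob : ∀ a, IsProbabilityMeasure (ν a)) (hsub : ∀ a, IsOneSubGaussian (ν a))
    (hbp : IsBanditProcess P ν arm reward) (l : Fin K → ℝ) (y : ℝ) (t : ℕ) :
    P.real {ω | ∃ s ≤ t, y ≤ logProcess (armMean ν) arm reward l s ω} ≤ Real.exp (-y) := by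
  refine (measureReal_mono ?_ (measure_ne_top _ _)).trans
    (measureReal_exists_exp_le_mixture_le hprob hsub hbp (ρ := Measure.dirac (0 : ℝ))
      (l := fun _ => l) measurable_const y t)
  rintro ω ⟨s, hs, h⟩
  refine ⟨s, hs, ?_⟩
  simp only [mixture, lintegral_const, measure_univ, mul_one]
  exact ENNReal.ofReal_le_ofReal (Real.exp_le_exp.2 h)

end Peeling

end GoodArm

end

noncomputable section

namespace GoodArm

/-! ### Deterministic analysis of the algorithm -/

section Pathwise

variable {Ω : Type*} {K : ℕ} {arm : ℕ → Ω → Fin K} {reward : ℕ → Ω → ℝ} {m : Fin K → ℝ}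
  {θ : ℝ} {ω : Ω} {t n₀ : ℕ} {x : ℝ}

lemma pulls_succ (a : Fin K) (t : ℕ) (ω : Ω) :
    pulls arm a (t + 1) ω = pulls arm a t ω + if arm t ω = a then 1 else 0 := by
  rw [pulls, Finset.range_add_one, Finset.filter_insert]
  split_ifs
  · rw [Finset.card_insert_of_notMem (by simp)]; rfl
  · rfl

lemma pulls_mono (a : Fin K) {s t : ℕ} (h : s ≤ t) (ω : Ω) :
    pulls arm a s ω ≤ pulls arm a t ω :=
  Finset.card_le_card (Finset.filter_subset_filter _ (Finset.range_mono h))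

lemma sum_pulls (t : ℕ) (ω : Ω) : ∑ a, pulls arm a t ω = t := by
  have := Finset.card_eq_sum_card_fiberwise (s := Finset.range t) (t := Finset.univ)
    (f := fun s => arm s ω) (fun _ _ => by simp)
  rw [Finset.card_range] at this
  exact this.symm

lemma sum_pulls_real (t : ℕ) (ω : Ω) : ∑ a, (pulls arm a t ω : ℝ) = t := by
  exact_mod_cast sum_pulls t ω

lemma exists_last_pull (a : Fin K) {r t : ℕ} (hrt : r ≤ t)
    (h : pulls arm a r ω < pulls arm a t ω) :
    ∃ s, r ≤ s ∧ s < t ∧ arm s ω = a ∧ pulls arm a s ω + 1 = pulls arm a t ω := by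
  induction t, hrt using Nat.le_induction with
  | base => exact absurd h (lt_irrefl _)
  | succ t hrt ih =>
    by_cases ha : arm t ω = a
    · exact ⟨t, hrt, Nat.lt_succ_self t, ha, by rw [pulls_succ, if_pos ha]⟩
    · have h0 : pulls arm a (t + 1) ω = pulls arm a t ω := by rw [pulls_succ, if_neg ha, add_zero]
      rw [h0] at h ⊢
      obtain ⟨s, h1, h2, h3⟩ := ih h
      exact ⟨s, h1, by omega, h3⟩

/-- Noise plus drift: the signed quantity whose positive and negative parts are the two
transportation costs. -/
lemma sqrt_mul_empMean_sub {a : Fin K} (h : 1 ≤ pulls arm a t ω) :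
    √(pulls arm a t ω : ℝ) * (empMean arm reward a t ω - θ) =
      centeredSum m arm reward a t ω / √(pulls arm a t ω : ℝ) +
        √(pulls arm a t ω : ℝ) * (m a - θ) := by
  have hn : (0 : ℝ) < pulls arm a t ω := by exact_mod_cast h
  have hs := Real.sqrt_pos.2 hn
  have hD : centeredSum m arm reward a t ω =
      (pulls arm a t ω : ℝ) * (empMean arm reward a t ω - m a) := by
    rw [centeredSum, empMean, Finset.sum_sub_distrib, Finset.sum_const, nsmul_eq_mul, mul_sub,
      mul_div_cancel₀ _ hn.ne']
    rfl
  rw [hD]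
  nth_rewrite 2 [← Real.mul_self_sqrt hn.le]
  field_simp
  ring

lemma Wplus_eq {a : Fin K} : Wplus θ arm reward a t ω =
    max (√(pulls arm a t ω : ℝ) * (empMean arm reward a t ω - θ)) 0 := by
  rw [Wplus, mul_max_of_nonneg _ _ (Real.sqrt_nonneg _), mul_zero]

lemma Wminus_eq {a : Fin K} : Wminus θ arm reward a t ω =
    max (-(√(pulls arm a t ω : ℝ) * (empMean arm reward a t ω - θ))) 0 := by
  rw [Wminus, mul_max_of_nonneg _ _ (Real.sqrt_nonneg _), mul_zero, mul_neg]

lemma Wplus_pos_of_lt {a : Fin K} (h : 1 ≤ pulls arm a t ω) (hθ : θ < empMean arm reward a t ω) :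
    0 < Wplus θ arm reward a t ω := by
  have hn : (0 : ℝ) < pulls arm a t ω := by exact_mod_cast h
  exact mul_pos (Real.sqrt_pos.2 hn) (lt_max_of_lt_left (sub_pos.2 hθ))

lemma Wplus_eq_of_pos {a : Fin K} (h : 0 < Wplus θ arm reward a t ω) :
    0 < √(pulls arm a t ω : ℝ) * (empMean arm reward a t ω - θ) := by
  rw [Wplus_eq] at h
  simpa using h

lemma one_le_pulls (hn₀ : 1 ≤ n₀) (hinit : ∀ a, pulls arm a (n₀ * K) ω = n₀) {s : ℕ}
    (hs : n₀ * K ≤ s) (a : Fin K) : 1 ≤ pulls arm a s ω :=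
  hn₀.trans ((hinit a).symm.le.trans (pulls_mono a hs ω))

/-- The arm pulled next has a positive empirical transportation cost if some empirical mean exceeds
the threshold. -/
lemma Wplus_arm_pos (hn₀ : 1 ≤ n₀) (hinit : ∀ a, pulls arm a (n₀ * K) ω = n₀)
    (habove : ∀ s, n₀ * K ≤ s → ¬ AllBelow θ arm reward s ω →
      ∀ b, Wplus θ arm reward b s ω ≤ Wplus θ arm reward (arm s ω) s ω)
    {s : ℕ} (hs : n₀ * K ≤ s) (h : ¬ AllBelow θ arm reward s ω) :
    0 < Wplus θ arm reward (arm s ω) s ω := by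
  have h' := h
  simp only [AllBelow, not_forall, not_le] at h'
  obtain ⟨c, hc⟩ := h'
  exact (Wplus_pos_of_lt (one_le_pulls hn₀ hinit hs c) hc).trans_le (habove s hs h c)

/-- An arm with many pulls has been pulled after the initialization with almost as many pulls. -/
lemma exists_pull_of_le (hn₀ : 1 ≤ n₀) (hinit : ∀ a, pulls arm a (n₀ * K) ω = n₀)
    (ht : n₀ * K ≤ t) {a : Fin K} {y : ℝ} (hy : 0 < y) (h : n₀ + y ≤ pulls arm a t ω) :
    ∃ s, n₀ * K ≤ s ∧ s < t ∧ arm s ω = a ∧ y ≤ pulls arm a s ω := by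
  obtain ⟨s, h1, h2, h3, h4⟩ := exists_last_pull (arm := arm) (ω := ω) a ht (by
    rw [hinit a]
    have : (n₀ : ℝ) < pulls arm a t ω := by linarith
    exact_mod_cast this)
  refine ⟨s, h1, h2, h3, ?_⟩
  have h5 : (pulls arm a s ω : ℝ) + 1 = pulls arm a t ω := by exact_mod_cast h4
  have h6 : (1 : ℝ) ≤ n₀ := by exact_mod_cast hn₀
  linarith

lemma le_sqrt_mul_of_le {n δ y R : ℝ} (hδ : 0 < δ) (hR : R ^ 2 ≤ y)
    (h : y * (δ ^ 2)⁻¹ ≤ n) : R ≤ √n * δ := by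
  rw [← div_eq_mul_inv, div_le_iff₀ (by positivity)] at h
  refine (Real.le_sqrt_of_sq_le (hR.trans h)).trans ?_
  rw [Real.sqrt_mul' _ (by positivity), Real.sqrt_sq hδ.le]

/-- If all arms are bad and no empirical mean deviates too much, all empirical means are below the
threshold. -/
lemma allBelow_of_concentration (hn₀ : 1 ≤ n₀) (hinit : ∀ a, pulls arm a (n₀ * K) ω = n₀)
    (hbelow : ∀ s, n₀ * K ≤ s → AllBelow θ arm reward s ω →
      ∀ b, Wminus θ arm reward (arm s ω) s ω ≤ Wminus θ arm reward b s ω)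
    (habove : ∀ s, n₀ * K ≤ s → ¬ AllBelow θ arm reward s ω →
      ∀ b, Wplus θ arm reward b s ω ≤ Wplus θ arm reward (arm s ω) s ω)
    (hm : ∀ a, m a < θ) (hx : 0 < x)
    (hdev : ∀ a, ∀ s ≤ t, 1 ≤ pulls arm a s ω →
      centeredSum m arm reward a s ω ^ 2 / pulls arm a s ω < 2 * x)
    (ht : n₀ * K ≤ t)
    (htx : n₀ * K + 18 * x * ∑ a, ((θ - m a) ^ 2)⁻¹ ≤ (t : ℝ)) :
    AllBelow θ arm reward t ω := by
  set R := √(2 * x) with hR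
  have hR2 : R ^ 2 = 2 * x := Real.sq_sqrt (by positivity)
  have hdev' : ∀ a, ∀ s ≤ t, 1 ≤ pulls arm a s ω →
      |centeredSum m arm reward a s ω / √(pulls arm a s ω : ℝ)| < R := fun a s hs h => by
    apply abs_lt_of_sq_lt_sq _ (Real.sqrt_nonneg _)
    rw [div_pow, Real.sq_sqrt (Nat.cast_nonneg _), hR2]
    exact hdev a s hs h
  by_contra hcon
  have hcon' := hcon
  simp only [AllBelow, not_forall, not_le] at hcon'
  obtain ⟨b, hb⟩ := hcon'
  -- Pigeonhole on the pull counts. The constant is `18x = (3R)²`, which makes the drift of `a` at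
  -- least `3R` in size at its last pull.
  obtain ⟨a, -, ha⟩ : ∃ a ∈ Finset.univ, (n₀ : ℝ) + 18 * x * ((θ - m a) ^ 2)⁻¹ ≤
      pulls arm a t ω := by
    refine Finset.exists_le_of_sum_le ⟨b, Finset.mem_univ b⟩ ?_
    rw [sum_pulls_real, Finset.sum_add_distrib, ← Finset.mul_sum, Finset.sum_const,
      Finset.card_univ, Fintype.card_fin, nsmul_eq_mul, mul_comm (K : ℝ)]
    exact htx
  have hδ : 0 < θ - m a := sub_pos.2 (hm a)
  obtain ⟨s, hs, hst, rfl, hn⟩ := exists_pull_of_le hn₀ hinit ht (by positivity) ha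
  have h1 : ∀ c, 1 ≤ pulls arm c s ω := one_le_pulls hn₀ hinit hs
  have hz : 3 * R ≤ √(pulls arm (arm s ω) s ω : ℝ) * (θ - m (arm s ω)) :=
    le_sqrt_mul_of_le hδ (by rw [mul_pow, hR2]; linarith) hn
  have hea := abs_lt.1 (hdev' (arm s ω) s hst.le (h1 _))
  have heq := sqrt_mul_empMean_sub (θ := θ) (reward := reward) (m := m) (h1 (arm s ω))
  by_cases hs' : AllBelow θ arm reward s ω
  · have hW := hbelow s hs hs' b
    have hWa : 2 * R < Wminus θ arm reward (arm s ω) s ω := by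
      rw [Wminus_eq]
      apply lt_max_of_lt_left
      rw [heq]
      linarith
    have hb1 : 1 ≤ pulls arm b t ω := one_le_pulls hn₀ hinit ht b
    have hbt := Wplus_eq_of_pos (Wplus_pos_of_lt hb1 hb)
    rw [sqrt_mul_empMean_sub (m := m) hb1] at hbt
    have heb := abs_lt.1 (hdev' b t le_rfl hb1)
    have heb' := abs_lt.1 (hdev' b s hst.le (h1 b))
    -- The drift of `b` only grows in size with time, so its bound `R` at time `t` carries back to
    -- `s`.
    have hzb : √(pulls arm b s ω : ℝ) * (θ - m b) ≤ √(pulls arm b t ω : ℝ) * (θ - m b) :=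
      mul_le_mul_of_nonneg_right (Real.sqrt_le_sqrt
        (by exact_mod_cast pulls_mono b hst.le ω)) (sub_pos.2 (hm b)).le
    have hWb : Wminus θ arm reward b s ω < 2 * R := by
      rw [Wminus_eq, sqrt_mul_empMean_sub (m := m) (h1 b)]
      refine max_lt ?_ (by positivity)
      linarith
    linarith
  · have := Wplus_eq_of_pos (Wplus_arm_pos hn₀ hinit habove hs hs')
    rw [heq] at this
    linarith [Real.sqrt_nonneg (2 * x)]

/-- The drift of a good arm is nonnegative, so only noise can push it below the threshold. This
supplies the `w` of a tilted pair. -/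
lemma Wminus_sq_le {a : Fin K} (h : 1 ≤ pulls arm a t ω) (hm : θ ≤ m a) :
    Wminus θ arm reward a t ω ^ 2 ≤ centeredSum m arm reward a t ω ^ 2 / pulls arm a t ω := by
  rw [← Real.sq_sqrt (Nat.cast_nonneg (pulls arm a t ω)), ← div_pow,
    ← sq_abs (_ / _), Wminus_eq,
    sqrt_mul_empMean_sub (m := m) h]
  have h1 := mul_nonneg (Real.sqrt_nonneg (pulls arm a t ω : ℝ)) (sub_nonneg.2 hm)
  refine pow_le_pow_left₀ (le_max_right _ _) (max_le ?_ (abs_nonneg _)) 2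
  linarith [neg_abs_le (centeredSum m arm reward a t ω / √(pulls arm a t ω : ℝ))]

lemma Wplus_sq_le {a : Fin K} (h : 1 ≤ pulls arm a t ω) (hm : m a ≤ θ) :
    Wplus θ arm reward a t ω ^ 2 ≤ centeredSum m arm reward a t ω ^ 2 / pulls arm a t ω := by
  rw [← Real.sq_sqrt (Nat.cast_nonneg (pulls arm a t ω)), ← div_pow,
    ← sq_abs (_ / _), Wplus_eq,
    sqrt_mul_empMean_sub (m := m) h]
  have h1 := mul_nonneg (Real.sqrt_nonneg (pulls arm a t ω : ℝ)) (sub_nonneg.2 hm)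
  refine pow_le_pow_left₀ (le_max_right _ _) (max_le ?_ (abs_nonneg _)) 2
  linarith [le_abs_self (centeredSum m arm reward a t ω / √(pulls arm a t ω : ℝ))]

/-- Pulling a bad arm `c` often requires joint deviations of `c` and of any good arm. -/
lemma exists_tilted_pair_of_bad_pull {c a₀ : Fin K} {s : ℕ}
    (hn₀ : 1 ≤ n₀) (hinit : ∀ a, pulls arm a (n₀ * K) ω = n₀)
    (hbelow : ∀ s, n₀ * K ≤ s → AllBelow θ arm reward s ω →
      ∀ b, Wminus θ arm reward (arm s ω) s ω ≤ Wminus θ arm reward b s ω)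
    (habove : ∀ s, n₀ * K ≤ s → ¬ AllBelow θ arm reward s ω →
      ∀ b, Wplus θ arm reward b s ω ≤ Wplus θ arm reward (arm s ω) s ω)
    (hc : m c < θ) (ha₀ : θ ≤ m a₀) (hx : 0 < x) (hs : n₀ * K ≤ s) (harm : arm s ω = c)
    (hn : 4 * x * ((θ - m c) ^ 2)⁻¹ ≤ pulls arm c s ω) :
    ∃ Z w : ℝ, 4 * x ≤ Z ^ 2 ∧
      3 * Z ^ 2 / 8 - Z * w / 2 ≤ logProcess m arm reward (Pi.single c ((θ - m c) / 2)) s ω ∧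
      w ^ 2 ≤ centeredSum m arm reward a₀ s ω ^ 2 / pulls arm a₀ s ω := by
  subst harm
  set c := arm s ω with hcdef
  have hδ : 0 < θ - m c := sub_pos.2 hc
  have h1 : ∀ c, 1 ≤ pulls arm c s ω := one_le_pulls hn₀ hinit hs
  set n := (pulls arm c s ω : ℝ) with hndef
  have hn0 : 0 < n := lt_of_lt_of_le (by positivity) hn
  set Z := √n * (θ - m c) with hZ
  have hZ0 : 0 < Z := mul_pos (Real.sqrt_pos.2 hn0) hδ
  have hZ2 : Z ^ 2 = n * (θ - m c) ^ 2 := by rw [hZ, mul_pow, Real.sq_sqrt hn0.le]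
  set e := centeredSum m arm reward c s ω / √n with he
  have hD : centeredSum m arm reward c s ω = e * √n := by
    rw [he, div_mul_cancel₀ _ (Real.sqrt_pos.2 hn0).ne']
  have heq : √n * (empMean arm reward c s ω - θ) = e - Z := by
    rw [hndef, sqrt_mul_empMean_sub (m := m) (h1 c), he, hZ]; ring
  have hlog : logProcess m arm reward (Pi.single c ((θ - m c) / 2)) s ω =
      Z * e / 2 - Z ^ 2 / 8 := by
    rw [logProcess_eq_sum, Finset.sum_eq_single c]
    · rw [Pi.single_eq_same, hD, hZ2, hZ]; ring
    · intro b _ hb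
      simp [Pi.single_eq_of_ne hb]
    · simp
  refine ⟨Z, Wminus θ arm reward a₀ s ω, ?_, ?_, Wminus_sq_le (h1 a₀) ha₀⟩
  · rw [hZ2]
    rwa [← div_eq_mul_inv, div_le_iff₀ (by positivity)] at hn
  -- If all means look bad, `c` minimizes `W⁻`, hence this bound; otherwise `c` itself looks good,
  -- so `Z - e < 0`.
  · have hkey : Z - e ≤ Wminus θ arm reward a₀ s ω := by
      by_cases hs' : AllBelow θ arm reward s ω
      · refine le_trans ?_ (hbelow s hs hs' a₀)
        rw [← hcdef, Wminus_eq, ← hndef, heq]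
        exact le_max_of_le_left (by linarith)
      · have h2 := Wplus_eq_of_pos (Wplus_arm_pos hn₀ hinit habove hs hs')
        rw [← hcdef, ← hndef, heq] at h2
        have h3 : 0 ≤ Wminus θ arm reward a₀ s ω := by rw [Wminus_eq]; exact le_max_right _ _
        linarith
    rw [hlog]
    nlinarith [mul_le_mul_of_nonneg_left hkey hZ0.le]

/-- The tilt which tests whether the good arms `A` are jointly underestimated. -/
def goodTilt (m : Fin K → ℝ) (θ : ℝ) (A : Finset (Fin K)) (a : Fin K) : ℝ :=
  if a ∈ A then -(2 * (∑ b ∈ A, ((m b - θ) ^ 2)⁻¹) * (m a - θ))⁻¹ else 0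

/-- Tilts inversely proportional to the gaps make every pull of a good arm gain the same drift term
`1/(2H)`, whatever the allocation, so only the total `N` matters and `Z² = N/H`. -/
lemma le_logProcess_goodTilt {A : Finset (Fin K)} (hA : ∀ a ∈ A, θ < m a)
    (hN : ∀ a ∈ A, 1 ≤ pulls arm a t ω) {w : ℝ} (hw0 : 0 ≤ w)
    (hw : ∀ a ∈ A, √(pulls arm a t ω : ℝ) * (empMean arm reward a t ω - θ) ≤ w)
    (hne : A.Nonempty)
    (hsum : 4 * x * ∑ a ∈ A, ((m a - θ) ^ 2)⁻¹ ≤ ∑ a ∈ A, (pulls arm a t ω : ℝ)) :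
    ∃ Z : ℝ, 4 * x ≤ Z ^ 2 ∧
      3 * Z ^ 2 / 8 - Z * w / 2 ≤ logProcess m arm reward (goodTilt m θ A) t ω := by
  set H := ∑ a ∈ A, ((m a - θ) ^ 2)⁻¹ with hH
  have hδ : ∀ a ∈ A, 0 < m a - θ := fun a ha => sub_pos.2 (hA a ha)
  have hH0 : 0 < H := Finset.sum_pos (fun a ha => by have := hδ a ha; positivity) hne
  set N := ∑ a ∈ A, (pulls arm a t ω : ℝ) with hNdef
  have hN0 : 0 ≤ N := Finset.sum_nonneg fun a _ => Nat.cast_nonneg _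
  have hZ2 : √(N / H) ^ 2 = N / H := Real.sq_sqrt (by positivity)
  refine ⟨√(N / H), ?_, ?_⟩
  · rw [hZ2, le_div_iff₀ hH0]; exact hsum
  -- Cauchy–Schwarz combines the losses due to `w` over the good arms.
  have hcs : ∑ a ∈ A, √(pulls arm a t ω : ℝ) * (m a - θ)⁻¹ ≤ √(N / H) * H := by
    have h := Finset.sum_mul_sq_le_sq_mul_sq A (fun a => √(pulls arm a t ω : ℝ))
      (fun a => (m a - θ)⁻¹)
    simp_rw [inv_pow, Real.sq_sqrt (Nat.cast_nonneg _)] at h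
    refine le_of_sq_le_sq ?_ (by positivity)
    rw [mul_pow, hZ2]
    refine h.trans (le_of_eq ?_)
    rw [← hNdef, ← hH]
    field_simp
  have hterm : ∀ a ∈ A, 3 * (pulls arm a t ω : ℝ) / (8 * H) -
      w / (2 * H) * (√(pulls arm a t ω : ℝ) * (m a - θ)⁻¹) ≤
      goodTilt m θ A a * centeredSum m arm reward a t ω -
        pulls arm a t ω * goodTilt m θ A a ^ 2 / 2 := by
    intro a ha
    have hd := hδ a ha
    have hn : (0 : ℝ) < pulls arm a t ω := by exact_mod_cast hN a ha
    have h1 := hw a ha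
    rw [sqrt_mul_empMean_sub (m := m) (hN a ha)] at h1
    -- Keeps the quadratic cost of the tilt below `1/(8H)` per pull, leaving `3/(8H)`.
    have hle : ((m a - θ) ^ 2)⁻¹ ≤ H :=
      Finset.single_le_sum (f := fun a => ((m a - θ) ^ 2)⁻¹) (fun b _ => by positivity) ha
    rw [goodTilt, if_pos ha, ← hH]
    set n := (pulls arm a t ω : ℝ)
    set D := centeredSum m arm reward a t ω
    set δ := m a - θ
    have hs := Real.sqrt_pos.2 hn
    have hss := Real.mul_self_sqrt hn.le
    have h2 : D + n * δ ≤ w * √n := by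
      have := mul_le_mul_of_nonneg_right h1 hs.le
      rw [add_mul, div_mul_cancel₀ _ hs.ne'] at this
      nlinarith
    have h3 : (2 * H * δ)⁻¹ * (D + n * δ) ≤ (2 * H * δ)⁻¹ * (w * √n) :=
      mul_le_mul_of_nonneg_left h2 (by positivity)
    have h4 : (2 * H * δ)⁻¹ * (D + n * δ) = (2 * H * δ)⁻¹ * D + n / (2 * H) := by
      field_simp
    have h5 : (2 * H * δ)⁻¹ * (w * √n) = w / (2 * H) * (√n * δ⁻¹) := by
      field_simp
    have h6 : n * (-(2 * H * δ)⁻¹) ^ 2 / 2 = n / (8 * H ^ 2) * (δ ^ 2)⁻¹ := by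
      field_simp
      ring
    have h7 : n / (8 * H ^ 2) * (δ ^ 2)⁻¹ ≤ n / (8 * H ^ 2) * H :=
      mul_le_mul_of_nonneg_left hle (by positivity)
    have h8 : n / (8 * H ^ 2) * H = n / (8 * H) := by field_simp
    have h9 : 3 * n / (8 * H) = n / (2 * H) - n / (8 * H) := by field_simp; ring
    rw [h6, h9]
    linarith
  have hlog : logProcess m arm reward (goodTilt m θ A) t ω = ∑ a ∈ A,
      (goodTilt m θ A a * centeredSum m arm reward a t ω -
        pulls arm a t ω * goodTilt m θ A a ^ 2 / 2) := by
    rw [logProcess_eq_sum]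
    refine (Finset.sum_subset (Finset.subset_univ A) fun a _ ha => ?_).symm
    simp [goodTilt, ha]
  rw [hlog]
  refine le_trans ?_ (Finset.sum_le_sum hterm)
  rw [Finset.sum_sub_distrib, ← Finset.sum_div, ← Finset.mul_sum, ← Finset.mul_sum, ← hNdef, hZ2]
  have h1 := mul_le_mul_of_nonneg_left hcs (show 0 ≤ w / (2 * H) by positivity)
  have h2 : w / (2 * H) * (√(N / H) * H) = √(N / H) * w / 2 := by field_simp
  have h3 : 3 * N / (8 * H) = 3 * (N / H) / 8 := by field_simp
  linarith

end Pathwise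

end GoodArm

end

noncomputable section

namespace GoodArm

/-! ### From deviation events to error probabilities -/

section Bounds

variable {Ω : Type*} [MeasurableSpace Ω] {P : Measure Ω} [IsProbabilityMeasure P] {K : ℕ}
  {n₀ : ℕ} {θ : ℝ} {ν : Fin K → Measure ℝ} {arm : ℕ → Ω → Fin K} {reward : ℕ → Ω → ℝ}
  {rec : ℕ → Ω → Option (Fin K)} {t : ℕ}

lemma exp_neg_p {x : ℝ} (hx : 0 < x) : Real.exp (-p x) = √x * Real.exp (-x) := by
  rw [Real.sqrt_eq_rpow, Real.rpow_def_of_pos hx, ← Real.exp_add, p]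
  ring_nf

lemma two_le_log (ht : 1 ≤ t) : 2 ≤ Real.log (Real.exp 1 ^ 2 * t) := by
  have ht0 : (1 : ℝ) ≤ t := by exact_mod_cast ht
  rw [Real.log_mul (by positivity) (by positivity), Real.log_pow, Real.log_exp]
  push_cast
  linarith [Real.log_nonneg ht0]

/-- From `log y ≥ 1 - 1/y` it suffices that `y + 1/(2y) ≤ 3/2`, an equality at both endpoints. -/
lemma p_le_one {y : ℝ} (h1 : 1 / 2 ≤ y) (h2 : y ≤ 1) : p y ≤ 1 := by
  have hy : 0 < y := by linarith
  have h := Real.one_sub_inv_le_log_of_pos (show 0 < y by linarith)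
  have h3 : y + y⁻¹ / 2 ≤ 3 / 2 := by
    rw [← sub_nonneg]
    have : 3 / 2 - (y + y⁻¹ / 2) = (1 - y) * (y - 1 / 2) / y := by field_simp; ring
    rw [this]
    exact div_nonneg (mul_nonneg (by linarith) (by linarith)) hy.le
  rw [p]
  linarith

lemma one_le_bound (hK : 1 ≤ K) (ht : 1 ≤ t) {y : ℝ} (h1 : 1 / 2 ≤ y) (h2 : y ≤ 1) :
    1 ≤ K * Real.exp 1 * √2 * Real.log (Real.exp 1 ^ 2 * t) * Real.exp (-p y) := by
  have hK' : (1 : ℝ) ≤ K := by exact_mod_cast hK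
  have hlog := two_le_log ht
  have h3 : Real.exp (-1) ≤ Real.exp (-p y) := Real.exp_le_exp.2 (by linarith [p_le_one h1 h2])
  have h4 : 1 ≤ √(2 : ℝ) := Real.one_le_sqrt.2 (by norm_num)
  calc (1 : ℝ) = 1 * Real.exp 1 * 1 * 1 * Real.exp (-1) := by
        rw [Real.exp_neg]; field_simp
    _ ≤ _ := by gcongr; linarith

lemma gap_sq (ν : Fin K → Measure ℝ) (θ : ℝ) (a : Fin K) :
    gap ν θ a ^ 2 = (armMean ν a - θ) ^ 2 := sq_abs _

lemma H1_pos (hK : 1 ≤ K) (hgap : ∀ a, 0 < gap ν θ a) : 0 < H1 ν θ :=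
  Finset.sum_pos (fun a _ => by have := hgap a; positivity)
    ⟨⟨0, by omega⟩, Finset.mem_univ _⟩

lemma alpha_pos : 0 < alpha ν θ := by
  unfold alpha; split_ifs <;> norm_num

lemma measureReal_errorEvent_le_of_no_good (hn₀ : 1 ≤ n₀)
    (hprob : ∀ a, IsProbabilityMeasure (ν a)) (hsub : ∀ a, IsOneSubGaussian (ν a))
    (hbandit : IsBanditProcess P ν arm reward) (halg : IsAPGAI P n₀ θ arm reward rec)
    (hgood : ¬ (goodArms ν θ).Nonempty) (ht : 1 ≤ t) (hnt : n₀ * K ≤ t) {x : ℝ} (hx : 1 ≤ x)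
    (htx : n₀ * K + 18 * x * H1 ν θ ≤ t) :
    P.real (errorEvent ν θ rec t) ≤
      K * Real.exp 1 * √2 * Real.log (Real.exp 1 ^ 2 * t) * Real.exp (-p x) := by
  have hm : ∀ a, armMean ν a < θ := fun a => by
    by_contra h
    exact hgood ⟨a, not_lt.1 h⟩
  set E : Fin K → Set Ω := fun a => {ω | ∃ s ≤ t, 1 ≤ pulls arm a s ω ∧
      2 * x ≤ centeredSum (armMean ν) arm reward a s ω ^ 2 / pulls arm a s ω} with hE
  have hsubset : errorEvent ν θ rec t ≤ᵐ[P] ⋃ a ∈ Finset.univ, E a := by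
    filter_upwards [halg.init, halg.step_below, halg.step_above] with ω hinit hbelow habove herr
    by_contra hcon
    have hdev : ∀ a, ∀ s ≤ t, 1 ≤ pulls arm a s ω →
        centeredSum (armMean ν) arm reward a s ω ^ 2 / pulls arm a s ω < 2 * x := by
      intro a s hs h1
      by_contra h2
      exact hcon (Set.mem_biUnion (Finset.mem_coe.2 (Finset.mem_univ a))
        ⟨s, hs, h1, not_lt.1 h2⟩)
    have hall := allBelow_of_concentration hn₀ hinit (fun s hs h => (hbelow s hs h).2)
      (fun s hs h => (habove s hs h).2) hm (by linarith) hdev hnt (by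
        refine le_trans (le_of_eq ?_) htx
        simp_rw [H1, gap_sq, ← neg_sub θ, neg_sq])
    rcases herr with h | h
    · exact hgood h.1
    · exact h.2 (hbelow t hnt hall).1
  have hlog := two_le_log ht
  calc P.real (errorEvent ν θ rec t) ≤ P.real (⋃ a ∈ Finset.univ, E a) :=
        ENNReal.toReal_mono (measure_ne_top _ _) (measure_mono_ae hsubset)
    _ ≤ ∑ a, P.real (E a) := measureReal_biUnion_finset_le _ _
    _ ≤ ∑ _a : Fin K, Real.log (Real.exp 1 ^ 2 * t) / 2 * (√(25 * x) * Real.exp (-x)) :=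
        Finset.sum_le_sum fun a _ => measureReal_exists_deviation_le hprob hsub hbandit a hx ht
    _ = K * (5 / 2) * Real.log (Real.exp 1 ^ 2 * t) * (√x * Real.exp (-x)) := by
        rw [Finset.sum_const, Finset.card_univ, Fintype.card_fin, nsmul_eq_mul,
          Real.sqrt_mul (by norm_num), show (25 : ℝ) = 5 ^ 2 by norm_num,
          Real.sqrt_sq (by norm_num)]
        ring
    _ ≤ K * (Real.exp 1 * √2) * Real.log (Real.exp 1 ^ 2 * t) * (√x * Real.exp (-x)) := by
        have h1 : (1 : ℝ) ≤ √2 := Real.one_le_sqrt.2 (by norm_num)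
        have h2 : 5 / 2 ≤ Real.exp 1 * √2 := by nlinarith [Real.exp_one_gt_d9]
        gcongr
    _ = _ := by rw [exp_neg_p (by linarith)]; ring

lemma measureReal_errorEvent_le_of_good (hn₀ : 1 ≤ n₀)
    (hprob : ∀ a, IsProbabilityMeasure (ν a)) (hsub : ∀ a, IsOneSubGaussian (ν a))
    (hgap : ∀ a, 0 < gap ν θ a)
    (hbandit : IsBanditProcess P ν arm reward) (halg : IsAPGAI P n₀ θ arm reward rec)
    (hgood : (goodArms ν θ).Nonempty) (ht : 1 ≤ t) (hnt : n₀ * K ≤ t) {x : ℝ} (hx : 1 ≤ x)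
    (htx : n₀ * K + 4 * x * H1 ν θ ≤ t) :
    P.real (errorEvent ν θ rec t) ≤
      K * Real.exp 1 * √2 * Real.log (Real.exp 1 ^ 2 * t) * Real.exp (-p x) := by
  classical
  have hx0 : 0 < x := by linarith
  set m := armMean ν with hmdef
  set A : Finset (Fin K) := Finset.univ.filter fun a => a ∈ goodArms ν θ with hA
  set B : Finset (Fin K) := Finset.univ.filter fun a => ¬ a ∈ goodArms ν θ with hB
  have hmA : ∀ a ∈ A, θ < m a := fun a ha => by
    have h1 : θ ≤ m a := (Finset.mem_filter.1 ha).2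
    have h2 := hgap a
    rw [gap, abs_pos, sub_ne_zero] at h2
    exact lt_of_le_of_ne h1 h2.symm
  have hmB : ∀ b ∈ B, m b < θ := fun b hb => not_le.1 (Finset.mem_filter.1 hb).2
  obtain ⟨a₀, ha₀⟩ := hgood
  have ha₀A : a₀ ∈ A := Finset.mem_filter.2 ⟨Finset.mem_univ _, ha₀⟩
  set tail : (Fin K → ℝ) → Fin K → Set Ω := fun l b =>
    {ω | ∃ s ≤ t, 1 ≤ pulls arm b s ω ∧ ∃ Z w : ℝ, 4 * x ≤ Z ^ 2 ∧
      3 * Z ^ 2 / 8 - Z * w / 2 ≤ logProcess m arm reward l s ω ∧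
      w ^ 2 ≤ centeredSum m arm reward b s ω ^ 2 / pulls arm b s ω} with htail
  set l₁ : Fin K → Fin K → ℝ := fun c => Pi.single c ((θ - m c) / 2) with hl₁
  set l₂ : Fin K → ℝ := goodTilt m θ A with hl₂
  set E₀ : Set Ω := {ω | ∃ s ≤ t, x ≤ logProcess m arm reward l₂ s ω} with hE₀
  have hsubset : errorEvent ν θ rec t ≤ᵐ[P]
      (((⋃ c ∈ B, tail (l₁ c) a₀) ∪ ⋃ b ∈ B, tail l₂ b) ∪ E₀ : Set Ω) := by
    filter_upwards [halg.init, halg.step_below, halg.step_above] with ω hinit hbelow habove herr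
    have hpulls := fun (s : ℕ) (hs : n₀ * K ≤ s) (a : Fin K) => one_le_pulls hn₀ hinit hs a
    -- Either some bad arm exceeds its share of the pulls, or the good arms jointly received theirs.
    by_cases hbig : ∃ c ∈ B, n₀ + 4 * x * ((θ - m c) ^ 2)⁻¹ ≤ pulls arm c t ω
    · obtain ⟨c, hc, hn⟩ := hbig
      have hδ : 0 < θ - m c := sub_pos.2 (hmB c hc)
      obtain ⟨s, hs, hst, harm, hn'⟩ := exists_pull_of_le hn₀ hinit hnt (by positivity) hn
      exact Or.inl (Or.inl (Set.mem_biUnion hc ⟨s, hst.le, hpulls s hs a₀,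
        exists_tilted_pair_of_bad_pull hn₀ hinit (fun s hs h => (hbelow s hs h).2)
          (fun s hs h => (habove s hs h).2) (hmB c hc) (hmA a₀ ha₀A).le hx0 hs harm hn'⟩))
    · push Not at hbig
      have hsum : 4 * x * ∑ a ∈ A, ((m a - θ) ^ 2)⁻¹ ≤ ∑ a ∈ A, (pulls arm a t ω : ℝ) := by
        have h1 := Finset.sum_filter_add_sum_filter_not Finset.univ (fun a => a ∈ goodArms ν θ)
          (fun a => (pulls arm a t ω : ℝ))
        rw [sum_pulls_real] at h1
        have h2 := Finset.sum_filter_add_sum_filter_not Finset.univ (fun a => a ∈ goodArms ν θ)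
          (fun a => (n₀ : ℝ) + 4 * x * ((m a - θ) ^ 2)⁻¹)
        rw [Finset.sum_add_distrib (s := Finset.univ), ← Finset.mul_sum, Finset.sum_const,
          Finset.card_univ, Fintype.card_fin, nsmul_eq_mul, mul_comm (K : ℝ)] at h2
        have h3 : ∑ b ∈ B, (pulls arm b t ω : ℝ) ≤
            ∑ b ∈ B, ((n₀ : ℝ) + 4 * x * ((m b - θ) ^ 2)⁻¹) :=
          Finset.sum_le_sum fun b hb => by
            rw [← neg_sub θ, neg_sq]; exact (hbig b hb).le
        have h4 : 4 * x * ∑ a ∈ A, ((m a - θ) ^ 2)⁻¹ ≤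
            ∑ a ∈ A, ((n₀ : ℝ) + 4 * x * ((m a - θ) ^ 2)⁻¹) := by
          rw [Finset.mul_sum]
          exact Finset.sum_le_sum fun a _ => le_add_of_nonneg_left (Nat.cast_nonneg _)
        simp_rw [H1, gap_sq] at htx
        linarith
      by_cases hall : AllBelow θ arm reward t ω
      · obtain ⟨Z, hZ, hlog⟩ := le_logProcess_goodTilt (w := 0) hmA
          (fun a _ => hpulls t hnt a) le_rfl (fun a _ => mul_nonpos_of_nonneg_of_nonpos
            (Real.sqrt_nonneg _) (sub_nonpos.2 (hall a))) ⟨a₀, ha₀A⟩ hsum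
        exact Or.inr ⟨t, le_rfl, by linarith⟩
      · have hrec := habove t hnt hall
        have hb : arm t ω ∈ B := by
          rw [hB, Finset.mem_filter]
          refine ⟨Finset.mem_univ _, ?_⟩
          rcases herr with ⟨-, h | ⟨a, ha, h⟩⟩ | ⟨h, -⟩
          · simp [hrec.1] at h
          · rw [hrec.1, Option.some_inj] at h
            rwa [h]
          · exact absurd ⟨a₀, ha₀⟩ h
        have hW0 : 0 ≤ Wplus θ arm reward (arm t ω) t ω := by
          rw [Wplus_eq]; exact le_max_right _ _
        obtain ⟨Z, hZ, hlog⟩ := le_logProcess_goodTilt (m := m) hmA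
          (fun a _ => hpulls t hnt a) hW0 (fun a _ => (le_max_left _ 0).trans
            (Wplus_eq.symm.le.trans (hrec.2 a))) ⟨a₀, ha₀A⟩ hsum
        exact Or.inl (Or.inr (Set.mem_biUnion hb ⟨t, le_rfl, hpulls t hnt _, Z, _, hZ, hlog,
          Wplus_sq_le (hpulls t hnt _) (hmB _ hb).le⟩))
  have hlog := two_le_log ht
  set L := Real.log (Real.exp 1 ^ 2 * t) with hL
  set β := L / 2 * (√(14 * x) * Real.exp (-x)) with hβ
  have hne : ∀ c ∈ B, a₀ ≠ c := by
    rintro c hc rfl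
    exact (Finset.mem_filter.1 hc).2 ha₀
  have h₁ : ∀ c ∈ B, P.real (tail (l₁ c) a₀) ≤ β := fun c hc =>
    measureReal_exists_tilted_pair_le hprob hsub hbandit
      (Pi.single_eq_of_ne (hne c hc) _) hx ht
  have h₂ : ∀ b ∈ B, P.real (tail l₂ b) ≤ β := fun b hb =>
    measureReal_exists_tilted_pair_le hprob hsub hbandit
      (if_neg fun h => (Finset.mem_filter.1 hb).2 (Finset.mem_filter.1 h).2) hx ht
  have h₀ : P.real E₀ ≤ Real.exp (-x) :=
    measureReal_exists_le_logProcess_le hprob hsub hbandit l₂ x t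
  -- Each bad arm accounts for two events of probability at most `β`; the good arm `a₀` leaves room
  -- for `E₀`.
  have hcard : (B.card : ℝ) + 1 ≤ K := by
    have h1 : B.card < (Finset.univ : Finset (Fin K)).card :=
      Finset.card_lt_card (Finset.ssubset_univ_iff.2 fun h =>
        hne a₀ (h ▸ Finset.mem_univ a₀) rfl)
    rw [Finset.card_univ, Fintype.card_fin] at h1
    exact_mod_cast h1
  -- Here `14 ≤ 2e²`, which is how the slice constant fits the stated prefactor.
  have hsq : √14 ≤ Real.exp 1 * √2 := by
    rw [Real.sqrt_le_left (by positivity), mul_pow, Real.sq_sqrt (by norm_num)]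
    nlinarith [Real.exp_one_gt_d9]
  have hsx : 1 ≤ √x := Real.one_le_sqrt.2 hx
  have hs2 : (1 : ℝ) ≤ √2 := Real.one_le_sqrt.2 (by norm_num)
  have he : 1 ≤ Real.exp 1 := Real.one_le_exp zero_le_one
  have hE₀le : Real.exp (-x) ≤ Real.exp 1 * √2 * L * (√x * Real.exp (-x)) := by
    calc Real.exp (-x) = 1 * 1 * 1 * (1 * Real.exp (-x)) := by ring
      _ ≤ _ := by gcongr; linarith
  calc P.real (errorEvent ν θ rec t)
      ≤ P.real (((⋃ c ∈ B, tail (l₁ c) a₀) ∪ ⋃ b ∈ B, tail l₂ b) ∪ E₀) :=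
        ENNReal.toReal_mono (measure_ne_top _ _) (measure_mono_ae hsubset)
    _ ≤ (∑ c ∈ B, P.real (tail (l₁ c) a₀) + ∑ b ∈ B, P.real (tail l₂ b)) + P.real E₀ :=
        (measureReal_union_le _ _).trans (add_le_add_left ((measureReal_union_le _ _).trans
          (add_le_add (measureReal_biUnion_finset_le _ _) (measureReal_biUnion_finset_le _ _))) _)
    _ ≤ (∑ _c ∈ B, β + ∑ _b ∈ B, β) + Real.exp (-x) :=
        add_le_add (add_le_add (Finset.sum_le_sum h₁) (Finset.sum_le_sum h₂)) h₀
    _ = B.card * (√14 * L * (√x * Real.exp (-x))) + Real.exp (-x) := by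
        rw [Finset.sum_const, nsmul_eq_mul, hβ, Real.sqrt_mul (by norm_num)]
        ring
    _ ≤ B.card * (Real.exp 1 * √2 * L * (√x * Real.exp (-x))) +
          Real.exp 1 * √2 * L * (√x * Real.exp (-x)) := by gcongr
    _ = (B.card + 1) * (Real.exp 1 * √2 * L * (√x * Real.exp (-x))) := by ring
    _ ≤ K * (Real.exp 1 * √2 * L * (√x * Real.exp (-x))) := by gcongr
    _ = _ := by rw [exp_neg_p hx0]; ring

lemma measureReal_errorEvent_le (hn₀ : 1 ≤ n₀) (hK : 1 ≤ K)
    (hprob : ∀ a, IsProbabilityMeasure (ν a)) (hsub : ∀ a, IsOneSubGaussian (ν a))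
    (hgap : ∀ a, 0 < gap ν θ a)
    (hbandit : IsBanditProcess P ν arm reward) (halg : IsAPGAI P n₀ θ arm reward rec)
    (ht : n₀ * K + 2 * (goodArms ν θ).ncard < t) :
    P.real (errorEvent ν θ rec t) ≤
      K * Real.exp 1 * √2 * Real.log (Real.exp 1 ^ 2 * t) *
        Real.exp (-p (max (scaledTime ν θ n₀ t) (1 / 2))) := by
  have ht1 : 1 ≤ t := by omega
  -- Below scaled time `1` the bound is at least `1`; the deviation estimates need `x ≥ 1`.
  rcases lt_or_ge (scaledTime ν θ n₀ t) 1 with hx | hx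
  · exact measureReal_le_one.trans
      (one_le_bound hK ht1 (le_max_right _ _) (max_le hx.le (by norm_num)))
  · rw [max_eq_left (by linarith)]
    have hH := H1_pos hK hgap
    have hα := alpha_pos (ν := ν) (θ := θ)
    have heq : scaledTime ν θ n₀ t * (2 * alpha ν θ * H1 ν θ) =
        (t : ℝ) - n₀ * K - 2 * (goodArms ν θ).ncard :=
      div_mul_cancel₀ _ (by positivity)
    have hcard : (0 : ℝ) ≤ (goodArms ν θ).ncard := Nat.cast_nonneg _
    by_cases hgood : (goodArms ν θ).Nonempty
    · rw [show alpha ν θ = 2 from if_pos hgood] at heq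
      exact measureReal_errorEvent_le_of_good hn₀ hprob hsub hgap hbandit halg hgood ht1
        (by omega) hx (by linarith)
    · rw [show alpha ν θ = 9 from if_neg hgood] at heq
      exact measureReal_errorEvent_le_of_no_good hn₀ hprob hsub hbandit halg hgood ht1
        (by omega) hx (by linarith)

/-! ### Asymptotic exponential rate -/

/-- The prefactors grow at most polynomially in `t`, so the spare factor `e^((1-c)t/D)` absorbs
them. -/
lemma eventually_bound_le (hK : 1 ≤ K) (hgap : ∀ a, 0 < gap ν θ a) {c : ℝ} (hc : c < 1) :
    ∀ᶠ t : ℕ in atTop, K * Real.exp 1 * √2 * Real.log (Real.exp 1 ^ 2 * t) *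
        Real.exp (-p (max (scaledTime ν θ n₀ t) (1 / 2))) ≤
      Real.exp (-(c * t / (2 * alpha ν θ * H1 ν θ))) := by
  have hD : 0 < 2 * alpha ν θ * H1 ν θ := by
    have := H1_pos hK hgap
    have := alpha_pos (ν := ν) (θ := θ)
    positivity
  set D := 2 * alpha ν θ * H1 ν θ with hDdef
  set C : ℝ := n₀ * K + 2 * (goodArms ν θ).ncard with hC
  have hC0 : 0 ≤ C := by positivity
  have hst : ∀ t : ℕ, scaledTime ν θ n₀ t = (t - C) / D := fun t => by
    rw [scaledTime, hC, sub_sub]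
  set κ : ℝ := K * Real.exp 1 * √2 * (1 / D + 1) * Real.exp (C / D) with hκ
  have hκ0 : 0 < κ := by
    have : (0 : ℝ) < K := by exact_mod_cast hK
    positivity
  have hε : 0 < (1 - c) / D := div_pos (by linarith) hD
  have hlim : ∀ᶠ t : ℕ in atTop, κ * ((2 + t) * (t + 1)) ≤ Real.exp ((1 - c) / D * t) := by
    have h1 : (fun y : ℝ => y ^ 2) =o[atTop] fun y => Real.exp ((1 - c) / D * y) :=
      isLittleO_pow_exp_pos_mul_atTop 2 hε
    have h2 := (h1.comp_tendsto tendsto_natCast_atTop_atTop).bound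
      (show 0 < 1 / (6 * κ) by positivity)
    filter_upwards [h2, eventually_ge_atTop 1] with t ht ht1
    have ht1' : (1 : ℝ) ≤ t := by exact_mod_cast ht1
    simp only [Function.comp, Real.norm_eq_abs, Real.abs_exp] at ht
    rw [abs_of_nonneg (by positivity)] at ht
    have h3 : 6 * κ * (t : ℝ) ^ 2 ≤ Real.exp ((1 - c) / D * t) := by
      calc 6 * κ * (t : ℝ) ^ 2 ≤ 6 * κ * (1 / (6 * κ) * Real.exp ((1 - c) / D * t)) := by gcongr
        _ = _ := by field_simp
    refine le_trans ?_ h3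
    have h4 : (2 + (t : ℝ)) * (t + 1) ≤ 6 * (t : ℝ) ^ 2 := by nlinarith
    calc κ * ((2 + (t : ℝ)) * (t + 1)) ≤ κ * (6 * (t : ℝ) ^ 2) := by gcongr
      _ = _ := by ring
  have hlarge : ∀ᶠ t : ℕ in atTop, C + D ≤ t :=
    tendsto_natCast_atTop_atTop.eventually_ge_atTop (C + D)
  filter_upwards [hlim, hlarge, eventually_ge_atTop 1] with t h1 h2 h3
  have ht1 : (1 : ℝ) ≤ t := by exact_mod_cast h3
  have hx : 1 ≤ scaledTime ν θ n₀ t := by rw [hst, le_div_iff₀ hD]; linarith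
  rw [max_eq_left (by linarith), exp_neg_p (by linarith)]
  have hsq : √(scaledTime ν θ n₀ t) ≤ (1 / D + 1) * (t + 1) := by
    have h4 : scaledTime ν θ n₀ t ≤ t / D := by rw [hst]; gcongr; linarith
    have h5 : √(scaledTime ν θ n₀ t) ≤ scaledTime ν θ n₀ t :=
      Real.sqrt_le_left (by linarith) |>.2 (by nlinarith)
    have h6 : (1 / D + 1) * ((t : ℝ) + 1) = t / D + 1 / D + t + 1 := by ring
    have h7 : 0 < 1 / D := by positivity
    linarith
  have hlog : Real.log (Real.exp 1 ^ 2 * t) ≤ 2 + t := by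
    rw [Real.log_mul (by positivity) (by positivity), Real.log_pow, Real.log_exp]
    push_cast
    linarith [Real.log_le_self (show (0 : ℝ) ≤ t by positivity)]
  have hexp : Real.exp (-scaledTime ν θ n₀ t) = Real.exp (C / D) * Real.exp (-(t / D)) := by
    rw [← Real.exp_add, hst]; congr 1; ring
  calc _ ≤ K * Real.exp 1 * √2 * (2 + t) *
        ((1 / D + 1) * (t + 1) * (Real.exp (C / D) * Real.exp (-(t / D)))) := by
        rw [hexp]; gcongr
    _ = κ * ((2 + t) * (t + 1)) * Real.exp (-(t / D)) := by rw [hκ]; ring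
    _ ≤ Real.exp ((1 - c) / D * t) * Real.exp (-(t / D)) := by gcongr
    _ = _ := by rw [← Real.exp_add]; congr 1; ring

end Bounds

end GoodArm

end

theorem theorem1 {Ω : Type*} [MeasurableSpace Ω] (P : Measure Ω) [IsProbabilityMeasure P]
    {K : ℕ} (n₀ : ℕ) (hn₀ : 1 ≤ n₀) (θ : ℝ)
    (ν : Fin K → Measure ℝ) (hprob : ∀ a, IsProbabilityMeasure (ν a))
    (hsub : ∀ a, GoodArm.IsOneSubGaussian (ν a)) (hgap : ∀ a, 0 < GoodArm.gap ν θ a)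
    (arm : ℕ → Ω → Fin K) (reward : ℕ → Ω → ℝ) (rec : ℕ → Ω → Option (Fin K))
    (hbandit : GoodArm.IsBanditProcess P ν arm reward)
    (halg : GoodArm.IsAPGAI P n₀ θ arm reward rec) :
    (∀ t : ℕ, n₀ * K + 2 * (GoodArm.goodArms ν θ).ncard < t →
      P.real (GoodArm.errorEvent ν θ rec t) ≤
        K * Real.exp 1 * √2 * Real.log (Real.exp 1 ^ 2 * t) *
          Real.exp (-GoodArm.p (max (GoodArm.scaledTime ν θ n₀ t) (1 / 2)))) ∧
    (∀ c : ℝ, c < 1 → ∀ᶠ t : ℕ in atTop,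
      P.real (GoodArm.errorEvent ν θ rec t) ≤
        Real.exp (-(c * t / (2 * GoodArm.alpha ν θ * GoodArm.H1 ν θ)))) := by
  have hK : 1 ≤ K := by
    obtain ⟨ω⟩ : Nonempty Ω := nonempty_of_isProbabilityMeasure P
    exact (arm 0 ω).pos
  refine ⟨fun t ht =>
    GoodArm.measureReal_errorEvent_le hn₀ hK hprob hsub hgap hbandit halg ht, fun c hc => ?_⟩
  filter_upwards [GoodArm.eventually_bound_le (n₀ := n₀) hK hgap hc,
    eventually_gt_atTop (n₀ * K + 2 * (GoodArm.goodArms ν θ).ncard)] with t h1 h2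
  exact (GoodArm.measureReal_errorEvent_le hn₀ hK hprob hsub hgap hbandit halg h2).trans h1
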